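/- **Setting.** Let $n,m\ge 0$, let $\Omega\subseteq\mathbb{C}^n$ be a domain, $F\supseteq\mathbb{C}$ a field of meromorphic functions on $\Omega$ in the variables $x_1,\dots,x_n$, and $\zeta\in\Omega$. Let $F\{U\}$ be the polynomial ring over $F$ in the indeterminates $u^{(j)}_\mu=\partial^\mu u^{(j)}$ ($1\le j\le m$, $\mu\in\mathbb{Z}_{\ge0}^n$) and $\mathbb{C}[G]$ the polynomial ring over $\mathbb{C}$ in indeterminates $g^{(j)}_\mu$. Fix an orderly ranking, that is, a total order on the pairs $(j,\mu)$ which is compatible with the derivations, satisfies $(j,\mu)<(j,\mu+e_i)$, where $e_i$ is the $i$-th unit vector, and satisfies $(j,\mu)<(j',\mu')$ whenever $|\mu|<|\mu'|$. An *algebraically restricted $\sigma$-system* consists of finitely many differential equations $p=0$ with $p\in F\{U\}$, finitely many equations $q=0$ with $q\in\mathbb{C}[G]$, and countably many inequations $q\neq0$ with $q\in\mathbb{C}[G]$. It is an *algebraically restricted system* if it is finite, and an *algebraic $\sigma$-system* if it contains no differential equations. If no coefficient of its differential equations has a pole at $\zeta$, then $\mathrm{Sol}_\zeta(S)$ denotes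 the set of all $m$-tuples of formal power series in $x_1-\zeta_1,\dots,x_n-\zeta_n$ that satisfy the differential equations (the coefficients being expanded at $\zeta$) and that satisfy the equations and inequations in $\mathbb{C}[G]$ when $g^{(j)}_\mu$ is replaced by the coefficient of $(x-\zeta)^\mu$ in the $j$-th series. For $\ell\in\mathbb{Z}_{\ge0}$ let $\mathrm{Sol}_\zeta(S)_{\le\ell}\subseteq\mathbb{C}^{N_\ell}$ be the set of tuples of coefficients with $|\mu|\le\ell$ of elements of $\mathrm{Sol}_\zeta(S)$, the coordinates being ordered increasingly by the ranking. *Algebraic counting polynomials.* Let $\pi_i:\mathbb{C}^N\to\mathbb{C}^i$ be the projection to the first $i$ coordinates; its fibres are regarded as subsets of $\mathbb{C}^{N-i}$. A constructible set has a counting polynomial in $\mathbb{Z}[\infty]$ determined by iterated application of the rules, for constructible sets $V,W$: (1) $c(V)=|V|$ for $V$ finite; (2) $c(V)=\infty$ for an affine line $V$; (3) $c(V\uplus W)=c(V)+c(W)$, which may be solved for each term; (4) $c(V)=c(W)\,c(\pi_i(V))$ if for some $1\le i\le N$ all non-empty fibres $W$ of $\pi_i$ on $V$ have the same value $c(W)$.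 An *algebraic counting polynomial* of an arbitrary set $V\subseteq\mathbb{C}^N$ is any element of $\mathbb{Z}[\infty,\aleph_0]$ that is obtained for $V$ from counting polynomials of constructible sets and from (5) $c(\mathbb{C}^1\setminus M)=\infty-\aleph_0$ for $M\subset\mathbb{C}^1$ countably infinite, by iterated formation of disjoint unions as in (3) and fibrations as in (4), for arbitrary sets. *Differential counting.* An $\ell$-th differential counting polynomial of $S$ is an algebraic counting polynomial of $\biguplus_{\widetilde S\in C}\mathrm{Sol}_\zeta(\widetilde S)_{\le\ell}$, where $C$ is a countable set of algebraic $\sigma$-systems such that this disjoint union equals $\mathrm{Sol}_\zeta(S)_{\le\ell}$. A *counting sequence* of $S$ is a sequence $c:\mathbb{Z}_{\ge0}\to\mathbb{Z}[\infty,\aleph_0]$ such that $c(\ell)$ is an $\ell$-th differential counting polynomial of $S$ for every $\ell$. Let $R$ be the ring of finite sums of terms $a(\ell,\aleph_0)\,\infty^{e_0+e_1\ell+e_2\ell^2/2!+\dots+e_n\ell^n/n!}$ with $a\in\mathbb{Q}[\ell,\aleph_0]$ and $e_0,\dots,e_n\in\mathbb{Q}$; it contains $\mathbb{Q}[\ell,\aleph_0,\infty,\infty^\ell,\infty^{\ell^2/2!},\dots,\infty^{\ell^n/n!}]$.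 A *differential counting polynomial* of $S$ is an element $p\in R$ such that some counting sequence $c$ of $S$ satisfies $c(\ell)=p(\ell)$ for all sufficiently large $\ell$. **Theorem.** Let $S_1,S_2$ be algebraically restricted systems of differential equations such that no coefficient of their differential equations has a pole at $\zeta$, and assume $\mathrm{Sol}_\zeta(S_1)\subseteq\mathrm{Sol}_\zeta(S_2)$. 1. Let $c_1,c_2$ be counting sequences of $S_1,S_2$ with $c_1(\ell),c_2(\ell)\in\mathbb{Z}[\infty]$ for all $\ell\ge0$. Then $\mathrm{Sol}_\zeta(S_1)=\mathrm{Sol}_\zeta(S_2)$ if and only if $c_1(\ell)=c_2(\ell)$ for all $\ell\ge0$. Moreover, $c_1$ is the only counting sequence of $S_1$. 2. Let $\bar c_1,\bar c_2\in R$ be differential counting polynomials of $S_1,S_2$ in which $\aleph_0$ does not occur. Then $\mathrm{Sol}_\zeta(S_1)=\mathrm{Sol}_\zeta(S_2)$ if and only if $\bar c_1=\bar c_2$. Moreover, $\bar c_1$ is the only differential counting polynomial of $S_1$ in $R$. -/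

import Mathlib

open Filter Topology Polynomial

noncomputable section

namespace DiffCount

/-! ### Algebraic counting polynomials

The ring `ℤ[∞, ℵ₀]` is `ℤ[X][X]`, the inner variable being `∞` and the outer one `ℵ₀`. The subring
`ℤ[∞]` is the range of the embedding `Polynomial.C : ℤ[X] → ℤ[X][X]`. -/

/-- The ring `ℤ[∞, ℵ₀]`. -/
abbrev CountRing : Type := ℤ[X][X]

/-- The indeterminate `∞` of `ℤ[∞, ℵ₀]`. -/
def infty : CountRing := C X

/-- The indeterminate `ℵ₀` of `ℤ[∞, ℵ₀]`. -/
def alephZero : CountRing := X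

/-- An element of `ℤ[∞, ℵ₀]` that lies in `ℤ[∞]`. -/
def InZInfty (p : CountRing) : Prop := ∃ q : ℤ[X], p = C q

/-- Solution set in affine space of finitely many equations `E` and inequations `I`. -/
def locallyClosed {N : ℕ} (E I : Finset (MvPolynomial (Fin N) ℂ)) : Set (Fin N → ℂ) :=
  {x | (∀ p ∈ E, MvPolynomial.eval x p = 0) ∧ ∀ q ∈ I, MvPolynomial.eval x q ≠ 0}

/-- Constructible subsets of affine space: finite unions of solution sets of finite systems of
polynomial equations and inequations. -/
def IsConstructible {N : ℕ} (V : Set (Fin N → ℂ)) : Prop :=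
  ∃ T : Finset (Finset (MvPolynomial (Fin N) ℂ) × Finset (MvPolynomial (Fin N) ℂ)),
    V = ⋃ t ∈ T, locallyClosed t.1 t.2

/-- The image of `V ⊆ ℂ^(i+j)` under the projection `π_i` to the first `i` coordinates. -/
def proj {i j : ℕ} (V : Set (Fin (i + j) → ℂ)) : Set (Fin i → ℂ) :=
  (fun x k => x (Fin.castAdd j k)) '' V

/-- The fibre of `V ⊆ ℂ^(i+j)` over `w ∈ ℂ^i` under `π_i`, as a subset of `ℂ^j`. -/
def fiber {i j : ℕ} (V : Set (Fin (i + j) → ℂ)) (w : Fin i → ℂ) : Set (Fin j → ℂ) :=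
  {v | Fin.append w v ∈ V}

/-- `IsConstructibleCount V p`: the rules for counting polynomials of constructible sets yield the
value `p ∈ ℤ[∞]` for `V`. The additivity rule `c(V ⊎ W) = c(V) + c(W)` is an identity between
constructible sets, and is used both to compute `c(V ⊎ W)` and to compute `c(V)`. -/
inductive IsConstructibleCount : {N : ℕ} → Set (Fin N → ℂ) → ℤ[X] → Prop
  | finite {N : ℕ} (V : Set (Fin N → ℂ)) (hV : V.Finite) :
      IsConstructibleCount V ((V.ncard : ℕ) : ℤ[X])
  | line {N : ℕ} (L : AffineSubspace ℂ (Fin N → ℂ)) (hL : Module.finrank ℂ L.direction = 1) :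
      IsConstructibleCount (L : Set (Fin N → ℂ)) X
  | add {N : ℕ} (V W : Set (Fin N → ℂ)) (p q : ℤ[X]) (hV : IsConstructible V)
      (hW : IsConstructible W) (hd : Disjoint V W)
      (hp : IsConstructibleCount V p) (hq : IsConstructibleCount W q) :
      IsConstructibleCount (V ∪ W) (p + q)
  | sub {N : ℕ} (V W : Set (Fin N → ℂ)) (p q : ℤ[X]) (hV : IsConstructible V)
      (hW : IsConstructible W) (hd : Disjoint V W)
      (hp : IsConstructibleCount (V ∪ W) p) (hq : IsConstructibleCount W q) :
      IsConstructibleCount V (p - q)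
  | fibration {i j : ℕ} (hi : 1 ≤ i) (V : Set (Fin (i + j) → ℂ)) (p q : ℤ[X])
      (hV : IsConstructible V) (hq : ∀ w ∈ proj V, IsConstructibleCount (fiber V w) q)
      (hp : IsConstructibleCount (proj V) p) :
      IsConstructibleCount V (q * p)

/-- `IsCount V p`: `p ∈ ℤ[∞, ℵ₀]` is an algebraic counting polynomial of the arbitrary subset `V`
of an affine space, i.e. it arises from counting polynomials of constructible sets by finite
disjoint unions, by fibrations, and by counting the complement of a countably infinite subset of
the affine line as `∞ - ℵ₀`. -/
inductive IsCount : {N : ℕ} → Set (Fin N → ℂ) → CountRing → Prop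
  | constructible {N : ℕ} (V : Set (Fin N → ℂ)) (p : ℤ[X]) (hV : IsConstructible V)
      (hp : IsConstructibleCount V p) : IsCount V (C p)
  | add {N : ℕ} (V W : Set (Fin N → ℂ)) (p q : CountRing) (hd : Disjoint V W)
      (hp : IsCount V p) (hq : IsCount W q) : IsCount (V ∪ W) (p + q)
  | fibration {i j : ℕ} (hi : 1 ≤ i) (V : Set (Fin (i + j) → ℂ)) (p q : CountRing)
      (hq : ∀ w ∈ proj V, IsCount (fiber V w) q) (hp : IsCount (proj V) p) :
      IsCount V (q * p)
  | cocountable (M : Set ℂ) (hc : M.Countable) (hi : M.Infinite) :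
      IsCount {x : Fin 1 → ℂ | x 0 ∉ M} (infty - alephZero)

/-! ### Fields of meromorphic functions in `n` variables -/

/-- The filter on `ℂ^n` generated by the relatively open dense subsets of `Ω`. -/
def denseOpen {n : ℕ} (Ω : Set (Fin n → ℂ)) : Filter (Fin n → ℂ) where
  sets := {s | ∃ U : Set (Fin n → ℂ), IsOpen U ∧ Ω ⊆ closure (Ω ∩ U) ∧ Ω ∩ U ⊆ s}
  univ_sets := ⟨Set.univ, isOpen_univ, by simpa using subset_closure, Set.subset_univ _⟩
  sets_of_superset := by
    rintro s t ⟨U, h1, h2, h3⟩ hst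
    exact ⟨U, h1, h2, h3.trans hst⟩
  inter_sets := by
    rintro s t ⟨U, h1, h2, h3⟩ ⟨U', h1', h2', h3'⟩
    refine ⟨U ∩ U', h1.inter h1', fun x hx => ?_,
      fun x hx => ⟨h3 ⟨hx.1, hx.2.1⟩, h3' ⟨hx.1, hx.2.2⟩⟩⟩
    refine closure_minimal (fun y hy => ?_) isClosed_closure (h2 hx)
    refine closure_mono ?_ (h1.inter_closure ⟨hy.2, h2' hy.1⟩)
    rintro z ⟨hz, hz', hz''⟩
    exact ⟨hz', hz, hz''⟩

/-- Complex valued functions on `Ω`, two functions being identified if they agree on a dense open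
subset of `Ω` (a meromorphic function need only be defined on such a subset). -/
abbrev GenericFunction {n : ℕ} (Ω : Set (Fin n → ℂ)) : Type := Germ (denseOpen Ω) ℂ

/-- `P x (f x)` holds for all `x` in a dense open part of a neighbourhood of `z`. -/
def HoldsNear {n : ℕ} {Ω : Set (Fin n → ℂ)} (f : GenericFunction Ω) (z : Fin n → ℂ)
    (P : (Fin n → ℂ) → ℂ → Prop) : Prop :=
  ∃ φ : (Fin n → ℂ) → ℂ, f = (φ : GenericFunction Ω) ∧ ∀ᶠ x in denseOpen Ω ⊓ 𝓝 z, P x (φ x)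

/-- Meromorphic functions on `Ω`: locally a quotient `g / h` of holomorphic functions, where `h`
does not vanish identically. -/
def IsMeromorphicOn {n : ℕ} {Ω : Set (Fin n → ℂ)} (f : GenericFunction Ω) : Prop :=
  ∀ z ∈ Ω, ∃ g h : (Fin n → ℂ) → ℂ, AnalyticAt ℂ g z ∧ AnalyticAt ℂ h z ∧
    (¬ ∀ᶠ x in 𝓝 z, h x = 0) ∧ HoldsNear f z fun x y => h x * y = g x

/-- `F` is a field of meromorphic functions on the domain `Ω ⊆ ℂ^n` containing the constants. -/
structure IsMeromorphicField {n : ℕ} (Ω : Set (Fin n → ℂ)) (F : Subring (GenericFunction Ω)) :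
    Prop where
  isOpen : IsOpen Ω
  isConnected : IsConnected Ω
  isField : IsField F
  const_mem : ∀ a : ℂ, (((fun _ => a) : (Fin n → ℂ) → ℂ) : GenericFunction Ω) ∈ F
  meromorphic : ∀ f ∈ F, IsMeromorphicOn f

/-- `f` is holomorphic at `ζ`, with Taylor series `φ`; here and below a power series in
`x_1 - ζ_1, …, x_n - ζ_n` is an element of `MvPowerSeries (Fin n) ℂ`. -/
def HasTaylorSeries {n : ℕ} {Ω : Set (Fin n → ℂ)} (ζ : Fin n → ℂ) (f : GenericFunction Ω)
    (φ : MvPowerSeries (Fin n) ℂ) : Prop :=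
  ∃ g : (Fin n → ℂ) → ℂ, HoldsNear f ζ (fun x y => y = g x) ∧
    ∀ᶠ x in 𝓝 ζ, HasSum
      (fun μ : Fin n →₀ ℕ => MvPowerSeries.coeff μ φ * ∏ i, (x i - ζ i) ^ μ i) (g x)

/-- `f` is holomorphic at `ζ`, that is, `ζ` is not a pole of `f`. -/
def HolomorphicAt {n : ℕ} {Ω : Set (Fin n → ℂ)} (ζ : Fin n → ℂ) (f : GenericFunction Ω) : Prop :=
  ∃ φ, HasTaylorSeries ζ f φ

open Classical in
/-- The Taylor series at `ζ` of a function that is holomorphic at `ζ`. -/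
def taylor {n : ℕ} {Ω : Set (Fin n → ℂ)} (ζ : Fin n → ℂ) (f : GenericFunction Ω) :
    MvPowerSeries (Fin n) ℂ :=
  if h : HolomorphicAt ζ f then h.choose else 0

/-! ### Algebraically restricted systems of differential equations and their solutions -/

/-- The index set of the indeterminates `u^(j)_μ` of `F{U}`, and of the indeterminates `g^(j)_μ` of
the polynomial ring `ℂ[G]` of power series coefficients. -/
abbrev DVar (n m : ℕ) : Type := Fin m × (Fin n →₀ ℕ)

/-- Orderly rankings: total orders on the `u^(j)_μ` that are compatible with the derivations and
with the order `|μ|`. -/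
structure IsOrderlyRanking {n m : ℕ} (r : LinearOrder (DVar n m)) : Prop where
  lt_deriv : ∀ (j : Fin m) (μ : Fin n →₀ ℕ) (i : Fin n),
    r.lt (j, μ) (j, μ + Finsupp.single i 1)
  deriv_lt_deriv : ∀ (j j' : Fin m) (μ μ' : Fin n →₀ ℕ) (i : Fin n),
    r.lt (j, μ) (j', μ') → r.lt (j, μ + Finsupp.single i 1) (j', μ' + Finsupp.single i 1)
  orderly : ∀ (j j' : Fin m) (μ μ' : Fin n →₀ ℕ),
    μ.degree < μ'.degree → r.lt (j, μ) (j', μ')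

/-- Algebraically restricted `σ`-systems of differential equations: finitely many differential
equations in `F{U}`, finitely many equations in `ℂ[G]`, countably many inequations in `ℂ[G]`. -/
structure SigmaSystem (n m : ℕ) {Ω : Set (Fin n → ℂ)} (F : Subring (GenericFunction Ω)) where
  diffEqs : Finset (MvPolynomial (DVar n m) F)
  coeffEqs : Finset (MvPolynomial (DVar n m) ℂ)
  coeffIneqs : Set (MvPolynomial (DVar n m) ℂ)
  countable_coeffIneqs : coeffIneqs.Countable

/-- The iterated derivative `∂^μ` of a power series. -/
def iterDeriv {n : ℕ} (μ : Fin n →₀ ℕ) (f : MvPowerSeries (Fin n) ℂ) : MvPowerSeries (Fin n) ℂ :=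
  (List.finRange n).foldr (fun i g => (MvPowerSeries.pderiv ℂ i)^[μ i] g) f

section

variable {n m : ℕ} {Ω : Set (Fin n → ℂ)} {F : Subring (GenericFunction Ω)}

/-- The power series obtained from a differential polynomial `p` by replacing `u^(j)_μ` by
`∂^μ f_j` and every coefficient by its Taylor series at `ζ`. -/
def evalDiff (ζ : Fin n → ℂ) (p : MvPolynomial (DVar n m) F)
    (f : Fin m → MvPowerSeries (Fin n) ℂ) : MvPowerSeries (Fin n) ℂ :=
  ∑ α ∈ p.support, taylor ζ ((p.coeff α : F) : GenericFunction Ω) *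
    ∏ v ∈ α.support, iterDeriv v.2 (f v.1) ^ α v

/-- The value of `p ∈ ℂ[G]` when `g^(j)_μ` is replaced by the coefficient of `(x - ζ)^μ` in
`f_j`. -/
def evalCoeff (p : MvPolynomial (DVar n m) ℂ) (f : Fin m → MvPowerSeries (Fin n) ℂ) : ℂ :=
  MvPolynomial.eval (fun v : DVar n m => MvPowerSeries.coeff v.2 (f v.1)) p

namespace SigmaSystem

/-- A system, as opposed to a `σ`-system, is finite. -/
def IsSystem (S : SigmaSystem n m F) : Prop := S.coeffIneqs.Finite

/-- An algebraic `σ`-system in `ℂ[G]`: there are no differential equations. -/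
def IsAlgebraic (S : SigmaSystem n m F) : Prop := S.diffEqs = ∅

/-- The coefficients of the differential equations of `S` have no pole at `ζ`. -/
def HolomorphicAt (S : SigmaSystem n m F) (ζ : Fin n → ℂ) : Prop :=
  ∀ p ∈ S.diffEqs, ∀ α, DiffCount.HolomorphicAt ζ ((p.coeff α : F) : GenericFunction Ω)

/-- The set of formal power series solutions of `S` around `ζ`. -/
def Sol (S : SigmaSystem n m F) (ζ : Fin n → ℂ) : Set (Fin m → MvPowerSeries (Fin n) ℂ) :=
  {f | (∀ p ∈ S.diffEqs, evalDiff ζ p f = 0) ∧ (∀ p ∈ S.coeffEqs, evalCoeff p f = 0) ∧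
    ∀ p ∈ S.coeffIneqs, evalCoeff p f ≠ 0}

end SigmaSystem

end

/-! ### Truncation -/

theorem finite_order_le (n m ℓ : ℕ) : {v : DVar n m | v.2.degree ≤ ℓ}.Finite :=
  (Set.finite_univ.prod (Finsupp.finite_of_degree_le (σ := Fin n) ℓ)).subset
    fun _ hv => ⟨Set.mem_univ _, hv⟩

/-- The indices `(j, μ)` with `|μ| ≤ ℓ`. -/
def truncIndex (n m ℓ : ℕ) : Finset (DVar n m) := (finite_order_le n m ℓ).toFinset

/-- The coefficients of order at most `ℓ` of a tuple of power series, listed increasingly with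
respect to the ranking `r`. This identifies the space of tuples of power series modulo those of
order greater than `ℓ` with the affine space over `ℂ` of dimension `(truncIndex n m ℓ).card`. -/
def truncate {n m : ℕ} (r : LinearOrder (DVar n m)) (ℓ : ℕ)
    (f : Fin m → MvPowerSeries (Fin n) ℂ) : Fin (truncIndex n m ℓ).card → ℂ := fun k =>
  let v : DVar n m := @Finset.orderEmbOfFin _ r (truncIndex n m ℓ) _ rfl k
  MvPowerSeries.coeff v.2 (f v.1)

section

variable {n m : ℕ} {Ω : Set (Fin n → ℂ)} {F : Subring (GenericFunction Ω)}

/-- The set of formal power series solutions of `S` around `ζ` truncated at order `ℓ`. -/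
def SigmaSystem.SolTrunc (r : LinearOrder (DVar n m)) (S : SigmaSystem n m F) (ζ : Fin n → ℂ)
    (ℓ : ℕ) : Set (Fin (truncIndex n m ℓ).card → ℂ) :=
  truncate r ℓ '' S.Sol ζ

/-! ### Counting sequences -/

/-- `p` is an `ℓ`-th differential counting polynomial of `S`: for a countable set `T` of algebraic
`σ`-systems whose truncated solution sets partition that of `S`, it is an algebraic counting
polynomial of the set described by `T`. -/
def IsDiffCount (r : LinearOrder (DVar n m)) (S : SigmaSystem n m F) (ζ : Fin n → ℂ) (ℓ : ℕ)
    (p : CountRing) : Prop :=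
  ∃ T : Set (SigmaSystem n m F), T.Countable ∧ (∀ A ∈ T, A.IsAlgebraic) ∧
    T.PairwiseDisjoint (fun A => A.SolTrunc r ζ ℓ) ∧
    S.SolTrunc r ζ ℓ = ⋃ A ∈ T, A.SolTrunc r ζ ℓ ∧
    IsCount (⋃ A ∈ T, A.SolTrunc r ζ ℓ) p

/-- `c` is a counting sequence of `S`. -/
def IsCountingSeq (r : LinearOrder (DVar n m)) (S : SigmaSystem n m F) (ζ : Fin n → ℂ)
    (c : ℕ → CountRing) : Prop :=
  ∀ ℓ, IsDiffCount r S ζ ℓ (c ℓ)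

end

/-! ### Differential counting polynomials -/

/-- The ring of finite sums of terms `a(ℓ, ℵ₀) ∞^(e_0 + e_1 ℓ + e_2 ℓ^2/2! + … + e_n ℓ^n/n!)` with
`a ∈ ℚ[ℓ, ℵ₀]` and `e_0, …, e_n ∈ ℚ`. The terms with `e_0, …, e_n ∈ ℕ` span the polynomial ring
`ℚ[ℓ, ℵ₀, ∞, ∞^ℓ, ∞^(ℓ^2/2!), …, ∞^(ℓ^n/n!)]`. In the coefficient ring `ℚ[X][X]` the inner variable
is `ℓ` and the outer one `ℵ₀`. -/
abbrev DiffCountRing (n : ℕ) : Type := AddMonoidAlgebra ℚ[X][X] (Fin (n + 1) → ℚ)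

/-- An element of `DiffCountRing n` in which `ℵ₀` does not occur. -/
def NoAleph {n : ℕ} (p : DiffCountRing n) : Prop := ∀ e, ∃ a : ℚ[X], p.coeff e = C a

/-- The ring `ℚ[ℵ₀][∞^q : q ∈ ℚ]`, where values for integers `ℓ` are compared. -/
abbrev ValueRing : Type := AddMonoidAlgebra ℚ[X] ℚ

/-- The value of an element of `DiffCountRing n` at an integer `ℓ ≥ 0`. -/
def valueAt {n : ℕ} (ℓ : ℕ) (p : DiffCountRing n) : ValueRing :=
  p.coeff.sum fun e a =>
    AddMonoidAlgebra.single (∑ i : Fin (n + 1), e i * ((ℓ : ℚ) ^ (i : ℕ) / (Nat.factorial i : ℚ)))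
      (a.map (evalRingHom (ℓ : ℚ)))

/-- The inclusion of `ℤ[∞, ℵ₀]` into `ℚ[ℵ₀][∞^q : q ∈ ℚ]`. -/
def toValueRing : CountRing →+* ValueRing :=
  eval₂RingHom (eval₂RingHom (Int.castRingHom ValueRing) (AddMonoidAlgebra.single 1 1))
    (AddMonoidAlgebra.single 0 X)

/-- `p` is a differential counting polynomial of `S`: a counting sequence of `S` takes the value of
`p` at `ℓ` for all large `ℓ`. -/
def IsDiffCountPoly {n m : ℕ} {Ω : Set (Fin n → ℂ)} {F : Subring (GenericFunction Ω)}
    (r : LinearOrder (DVar n m)) (S : SigmaSystem n m F) (ζ : Fin n → ℂ) (p : DiffCountRing n) :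
    Prop :=
  ∃ c : ℕ → CountRing, IsCountingSeq r S ζ c ∧ ∀ᶠ ℓ in atTop, toValueRing (c ℓ) = valueAt ℓ p

end DiffCount

end

open DiffCount

open Filter Topology Polynomial

noncomputable section

namespace DiffCount

/-! ### Nonnegativity for large arguments in `ℤ[X]` -/

/-! The truncated solution sets of the two systems are nested for every order, so the theorem rests
on two facts about arbitrary subsets of affine space. A counting polynomial in `ℤ[∞]` is the only
counting polynomial (`IsCount.unique`), and nested sets sharing one coincide
(`IsCount.eq_of_subset`). Equality of all large truncations then gives equality of the solution
sets, because a tuple approximated to every order by solutions is a solution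
(`SigmaSystem.mem_Sol_of_truncate_mem`).

Both facts come from replacing the counting rules by integration over one coordinate after the
other. For constructible sets, `TameCount` integrates functions that are constant off a finite set,
the line having measure `∞` and a point measure `1`. This integral is determined by the function and
is linear, so it respects all the rules. Its values are nonnegative for large `∞` and vanish only on
empty sets, so the difference of nested sets with equal counts, having count `0`, is empty.

With `ℵ₀`, integrals of step functions are no longer determined: removing one more point from the
complement of a countably infinite set leaves the count `∞ - ℵ₀` unchanged. However, all counts lie
in a cone without cancellation (`InCone`). If a sum lies in `ℤ[∞]`, so does every summand, which
excludes nonzero steps on cocountable sets in every coordinate; hence a set with a count in `ℤ[∞]`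
is tame (`WildCount.tameCount_of_C`). Conversely, nonzero cocountable steps cannot add up to a
function constant off a finite set, since their values on the removed points drop and nothing
compensates for infinitely many drops (`StepIntegral.isTameIntegral`). So every count of a tame set
is its tame count (`WildCount.eq_C_of_tameCount`).

For elements of `R`, evaluation at all large `ℓ` is injective, which reduces the second part to the
same facts. -/

/-- A polynomial whose values at all large integers are nonnegative. -/
def EventuallyNonneg (p : ℤ[X]) : Prop := ∀ᶠ x : ℤ in atTop, 0 ≤ p.eval x

/-- A polynomial whose values at all large integers are positive. -/
def EventuallyPos (p : ℤ[X]) : Prop := ∀ᶠ x : ℤ in atTop, 0 < p.eval x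

namespace EventuallyNonneg

theorem zero : EventuallyNonneg 0 := .of_forall fun _ => by simp

theorem one : EventuallyNonneg 1 := .of_forall fun _ => by simp

theorem add {p q : ℤ[X]} (hp : EventuallyNonneg p) (hq : EventuallyNonneg q) :
    EventuallyNonneg (p + q) := by
  filter_upwards [hp, hq] with x h1 h2
  rw [eval_add]
  exact add_nonneg h1 h2

theorem mul {p q : ℤ[X]} (hp : EventuallyNonneg p) (hq : EventuallyNonneg q) :
    EventuallyNonneg (p * q) := by
  filter_upwards [hp, hq] with x h1 h2
  rw [eval_mul]
  exact mul_nonneg h1 h2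

theorem sum {ι : Type*} (s : Finset ι) {f : ι → ℤ[X]} (hf : ∀ i ∈ s, EventuallyNonneg (f i)) :
    EventuallyNonneg (∑ i ∈ s, f i) := by
  classical
  induction s using Finset.induction_on with
  | empty => simpa using zero
  | insert a s ha ih =>
    rw [Finset.sum_insert ha]
    exact (hf a (Finset.mem_insert_self _ _)).add
      (ih fun i hi => hf i (Finset.mem_insert_of_mem hi))

theorem X_sub_natCast (n : ℕ) : EventuallyNonneg (X - (n : ℤ[X])) := by
  filter_upwards [eventually_ge_atTop (n : ℤ)] with x hx
  simpa using hx

end EventuallyNonneg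

theorem eventually_eval_ne_zero {p : ℤ[X]} (hp : p ≠ 0) : ∀ᶠ x : ℤ in atTop, p.eval x ≠ 0 := by
  obtain ⟨b, hb⟩ := (finite_setOfPred_isRoot hp).bddAbove
  filter_upwards [eventually_gt_atTop b] with x hx h
  exact absurd (hb h) (not_le.2 hx)

theorem EventuallyNonneg.pos {p : ℤ[X]} (hp : EventuallyNonneg p) (h0 : p ≠ 0) :
    EventuallyPos p := by
  filter_upwards [hp, eventually_eval_ne_zero h0] with x h1 h2
  exact lt_of_le_of_ne h1 h2.symm

theorem EventuallyPos.nonneg {p : ℤ[X]} (hp : EventuallyPos p) : EventuallyNonneg p :=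
  hp.mono fun _ => le_of_lt

theorem EventuallyPos.ne_zero {p : ℤ[X]} (hp : EventuallyPos p) : p ≠ 0 := by
  rintro rfl
  obtain ⟨x, hx⟩ := hp.exists
  simp at hx

theorem EventuallyPos.add_nonneg {p q : ℤ[X]} (hp : EventuallyPos p) (hq : EventuallyNonneg q) :
    EventuallyPos (p + q) := by
  filter_upwards [hp, hq] with x h1 h2
  rw [eval_add]
  exact add_pos_of_pos_of_nonneg h1 h2

theorem EventuallyPos.mul {p q : ℤ[X]} (hp : EventuallyPos p) (hq : EventuallyPos q) :
    EventuallyPos (p * q) := by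
  filter_upwards [hp, hq] with x h1 h2
  rw [eval_mul]
  exact mul_pos h1 h2

/-- The cone of eventually nonnegative polynomials is pointed, as a nonzero element is eventually
strictly positive. Every later argument without cancellation rests on this. -/
theorem EventuallyNonneg.eq_zero_of_neg {p : ℤ[X]} (hp : EventuallyNonneg p)
    (hn : EventuallyNonneg (-p)) : p = 0 := by
  by_contra h
  obtain ⟨x, h1, h2⟩ := ((hp.pos h).and hn).exists
  rw [eval_neg] at h2
  omega

theorem EventuallyNonneg.eq_zero_of_add {p q : ℤ[X]} (hp : EventuallyNonneg p)
    (hq : EventuallyNonneg q) (h : p + q = 0) : p = 0 ∧ q = 0 := by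
  have h1 : p = 0 := hp.eq_zero_of_neg (by rwa [neg_eq_of_add_eq_zero_right h])
  exact ⟨h1, by simpa [h1] using h⟩

theorem EventuallyNonneg.eq_zero_of_sum {ι : Type*} {s : Finset ι} {f : ι → ℤ[X]}
    (hf : ∀ i ∈ s, EventuallyNonneg (f i)) (h : ∑ i ∈ s, f i = 0) : ∀ i ∈ s, f i = 0 := by
  classical
  intro i hi
  rw [← Finset.add_sum_erase s f hi] at h
  exact ((hf i hi).eq_zero_of_add
    (EventuallyNonneg.sum _ fun j hj => hf j (Finset.mem_of_mem_erase hj)) h).1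

/-! ### Iterated counting -/

open Classical in
/-- Counting of sets of lists of length `N`, one coordinate at a time: `I h p` expresses that the
function `h` on the first coordinate, whose values are the counts of the fibres, has integral
`p`. -/
def IteratedCount {R : Type*} [Semiring R] (I : (ℂ → R) → R → Prop) :
    ℕ → Set (List ℂ) → R → Prop
  | 0, S, p => p = if [] ∈ S then 1 else 0
  | N + 1, S, p => ∃ h, I h p ∧ ∀ x, IteratedCount I N {l | x :: l ∈ S} (h x)

namespace IteratedCount

section

variable {R : Type*} [CommRing R] {I : (ℂ → R) → R → Prop}

theorem empty (hI : I 0 0) : ∀ {N : ℕ} {S : Set (List ℂ)},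
    (∀ l, l.length = N → l ∉ S) → IteratedCount I N S 0
  | 0, S, h => by simp [IteratedCount, h [] rfl]
  | N + 1, S, h => ⟨0, hI, fun x => empty hI fun l hl => h (x :: l) (by simp [hl])⟩

theorem union (hI : ∀ h h' p p', I h p → I h' p' → I (h + h') (p + p')) :
    ∀ {N : ℕ} {S T : Set (List ℂ)} {p q : R}, Disjoint S T →
      IteratedCount I N S p → IteratedCount I N T q → IteratedCount I N (S ∪ T) (p + q)
  | 0, S, T, p, q, hd, hp, hq => by
    have : [] ∈ S → [] ∉ T := fun h => Set.disjoint_left.1 hd h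
    simp only [IteratedCount, Set.mem_union] at *
    subst hp hq
    by_cases h1 : [] ∈ S <;> by_cases h2 : [] ∈ T <;> simp_all
  | N + 1, S, T, p, q, hd, ⟨h, hp, hS⟩, ⟨h', hq, hT⟩ =>
    ⟨h + h', hI _ _ _ _ hp hq, fun x => union hI
      (Set.disjoint_left.2 fun l h1 h2 => Set.disjoint_left.1 hd h1 h2) (hS x) (hT x)⟩

/-- Closure of `I` under subtraction is available for `IsTameIntegral` but not for `StepIntegral`,
whose values lie in a cone. This matches the rules: only constructible counts may be solved for a
term. -/
theorem diff (hI : ∀ h h' p p', I h p → I h' p' → I (h - h') (p - p')) :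
    ∀ {N : ℕ} {S T : Set (List ℂ)} {p q : R}, Disjoint S T →
      IteratedCount I N (S ∪ T) p → IteratedCount I N T q → IteratedCount I N S (p - q)
  | 0, S, T, p, q, hd, hp, hq => by
    have : [] ∈ S → [] ∉ T := fun h => Set.disjoint_left.1 hd h
    simp only [IteratedCount, Set.mem_union] at *
    subst hp hq
    by_cases h1 : [] ∈ S <;> by_cases h2 : [] ∈ T <;> simp_all
  | N + 1, S, T, p, q, hd, ⟨h, hp, hS⟩, ⟨h', hq, hT⟩ =>
    ⟨h - h', hI _ _ _ _ hp hq, fun x => diff hI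
      (Set.disjoint_left.2 fun l h1 h2 => Set.disjoint_left.1 hd h1 h2) (hS x) (hT x)⟩

theorem fibration {q : R} (hI0 : I 0 0) (hI : ∀ h p, I h p → I (fun x => q * h x) (q * p)) :
    ∀ {i j : ℕ} {S P : Set (List ℂ)} {p : R},
      (∀ w, w.length = i → (w ∈ P ↔ ∃ v, v.length = j ∧ w ++ v ∈ S)) →
      (∀ w, w.length = i → w ∈ P → IteratedCount I j {v | w ++ v ∈ S} q) →
      IteratedCount I i P p → IteratedCount I (i + j) S (q * p)
  | 0, j, S, P, p, hP, hS, hp => by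
    rw [zero_add]
    simp only [IteratedCount] at hp
    subst hp
    -- No base coordinate is left: either the base is a point and `S` is its own single fibre, or
    -- the base is empty and `S` has no list of length `j`.
    split_ifs with h
    · simpa using hS [] rfl h
    · rw [mul_zero]
      exact empty hI0 fun l hl hlS => h ((hP [] rfl).2 ⟨l, hl, hlS⟩)
  | i + 1, j, S, P, p, hP, hS, ⟨h, hp, hh⟩ => by
    rw [Nat.succ_add]
    exact ⟨_, hI _ _ hp, fun x => fibration hI0 hI
      (fun w hw => hP (x :: w) (by simp [hw])) (fun w hw hwP => hS (x :: w) (by simp [hw]) hwP)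
      (hh x)⟩

end

end IteratedCount

/-! ### Integration of functions that are constant up to finitely many values -/

/-- The function `h` is constant up to finitely many values, and has the integral `p` when the
affine line has measure `t` and points have measure `1`. -/
def IsTameIntegral {R : Type*} [CommRing R] (t : R) (h : ℂ → R) (p : R) : Prop :=
  ∃ g, (Function.support fun x => h x - g).Finite ∧ p = t * g + ∑ᶠ x, (h x - g)

namespace IsTameIntegral

variable {R : Type*} [CommRing R] {t : R}

theorem const (g : R) : IsTameIntegral t (fun _ => g) (t * g) :=
  ⟨g, by simp, by simp⟩

theorem zero : IsTameIntegral t 0 0 := ⟨0, by simp, by simp⟩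

theorem add {h h' : ℂ → R} {p p' : R} (H : IsTameIntegral t h p) (H' : IsTameIntegral t h' p') :
    IsTameIntegral t (h + h') (p + p') := by
  obtain ⟨g, hg, rfl⟩ := H
  obtain ⟨g', hg', rfl⟩ := H'
  have e : (fun x => (h + h') x - (g + g')) = fun x => (h x - g) + (h' x - g') := by
    funext x; simp only [Pi.add_apply]; ring
  refine ⟨g + g', ?_, ?_⟩
  · rw [e]
    exact (hg.union hg').subset (Function.support_add _ _)
  · rw [e, finsum_add_distrib hg hg']
    ring

theorem mul_left (q : R) {h : ℂ → R} {p : R} (H : IsTameIntegral t h p) :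
    IsTameIntegral t (fun x => q * h x) (q * p) := by
  obtain ⟨g, hg, rfl⟩ := H
  have e : (fun x => q * h x - q * g) = fun x => q * (h x - g) := by
    funext x; ring
  refine ⟨q * g, ?_, ?_⟩
  · rw [e]
    exact hg.subset fun x hx hx' => hx (by simp [hx'])
  · rw [e, ← mul_finsum' _ _ hg]
    ring

theorem sub {h h' : ℂ → R} {p p' : R} (H : IsTameIntegral t h p) (H' : IsTameIntegral t h' p') :
    IsTameIntegral t (h - h') (p - p') := by
  have := H.add (H'.mul_left (-1))
  convert this using 1
  · funext x; simp [sub_eq_add_neg]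
  · ring

theorem single (a : ℂ) (q : R) : IsTameIntegral t (Pi.single a q) q := by
  classical
  refine ⟨0, ?_, ?_⟩
  · refine (Set.finite_singleton a).subset fun x hx => ?_
    by_contra h
    exact hx (by simp [Pi.single_eq_of_ne h])
  · rw [finsum_eq_single _ a fun x hx => by simp [Pi.single_eq_of_ne hx]]
    simp

/-- Since `ℂ` is infinite, two values each taken off a finite set agree, and the generic value
determines the integral. -/
theorem unique {h : ℂ → R} {p p' : R} (H : IsTameIntegral t h p) (H' : IsTameIntegral t h p') :
    p = p' := by
  obtain ⟨g, hg, rfl⟩ := H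
  obtain ⟨g', hg', rfl⟩ := H'
  obtain ⟨x, hx⟩ := (hg.union hg').exists_notMem
  simp only [Set.mem_union, Function.mem_support, not_or, not_not] at hx
  have : g = g' := by rw [← sub_eq_zero.1 hx.1, sub_eq_zero.1 hx.2]
  rw [this]

theorem exists_finset {h : ℂ → R} {p : R} (H : IsTameIntegral t h p) :
    ∃ (g : R) (E : Finset ℂ), (∀ x ∉ E, h x = g) ∧ p = (t - E.card) * g + ∑ x ∈ E, h x := by
  obtain ⟨g, hg, rfl⟩ := H
  refine ⟨g, hg.toFinset, fun x hx => ?_, ?_⟩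
  · by_contra hne
    exact hx (hg.mem_toFinset.2 (sub_ne_zero.2 hne))
  · rw [finsum_eq_sum _ hg, Finset.sum_sub_distrib, Finset.sum_const, nsmul_eq_mul]
    ring

theorem of_finset {h : ℂ → R} {g : R} (E : Finset ℂ) (hE : ∀ x ∉ E, h x = g) :
    IsTameIntegral t h ((t - E.card) * g + ∑ x ∈ E, h x) := by
  have hs : (Function.support fun x => h x - g) ⊆ E := fun x hx => by
    by_contra hne
    exact hx (sub_eq_zero.2 (hE x hne))
  refine ⟨g, E.finite_toSet.subset hs, ?_⟩
  rw [finsum_eq_sum_of_support_subset _ hs, Finset.sum_sub_distrib, Finset.sum_const, nsmul_eq_mul]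
  ring

theorem map {R' : Type*} [CommRing R'] (f : R →+* R') {h : ℂ → R} {p : R}
    (H : IsTameIntegral t h p) : IsTameIntegral (f t) (fun x => f (h x)) (f p) := by
  obtain ⟨g, E, hE, rfl⟩ := H.exists_finset
  convert of_finset (t := f t) (h := fun x => f (h x)) (g := f g) E fun x hx => by rw [hE x hx]
  simp

end IsTameIntegral

/-! ### Counting in `ℤ[∞]` -/

/-- Iterated counting in `ℤ[∞]` of sets of lists. -/
abbrev TameCount : ℕ → Set (List ℂ) → ℤ[X] → Prop := IteratedCount (IsTameIntegral X)

namespace TameCount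

theorem unique : ∀ {N : ℕ} {S : Set (List ℂ)} {p q : ℤ[X]},
    TameCount N S p → TameCount N S q → p = q
  | 0, _, _, _, hp, hq => by simp only [TameCount, IteratedCount] at *; rw [hp, hq]
  | N + 1, S, p, q, ⟨h, hp, hS⟩, ⟨h', hq, hS'⟩ => by
    obtain rfl : h = h' := funext fun x => unique (hS x) (hS' x)
    exact hp.unique hq

/-- By induction the integral `(X - |E|) g + ∑ h x` is a sum of eventually nonnegative terms. If it
vanishes, so do all terms, hence all fibre counts, and all fibres are empty. -/
theorem nonneg_and_eq_empty : ∀ {N : ℕ} {S : Set (List ℂ)} {p : ℤ[X]}, TameCount N S p →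
    EventuallyNonneg p ∧ (p = 0 → ∀ l, l.length = N → l ∉ S)
  | 0, S, p, hp => by
    simp only [TameCount, IteratedCount] at hp
    subst hp
    split_ifs with h
    · exact ⟨.one, fun h => absurd h one_ne_zero⟩
    · exact ⟨.zero, fun _ l hl => by rwa [List.length_eq_zero_iff.1 hl]⟩
  | N + 1, S, p, ⟨h, hp, hS⟩ => by
    obtain ⟨g, E, hE, rfl⟩ := hp.exists_finset
    have ih := fun x => nonneg_and_eq_empty (hS x)
    -- The generic value is itself the count of some fibre, so the induction hypothesis applies to
    -- it.
    obtain ⟨y, hy⟩ := E.finite_toSet.exists_notMem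
    have hg : EventuallyNonneg g := hE y hy ▸ (ih y).1
    have h1 := (EventuallyNonneg.X_sub_natCast E.card).mul hg
    have h2 := EventuallyNonneg.sum E fun x _ => (ih x).1
    refine ⟨h1.add h2, fun h0 => ?_⟩
    obtain ⟨h3, h4⟩ := h1.eq_zero_of_add h2 h0
    have hX : X - (E.card : ℤ[X]) ≠ 0 := by simpa using X_sub_C_ne_zero (E.card : ℤ)
    have hg0 : g = 0 := (mul_eq_zero.1 h3).resolve_left hX
    have h5 : ∀ x, h x = 0 := fun x => by
      by_cases hx : x ∈ E
      · exact EventuallyNonneg.eq_zero_of_sum (fun x _ => (ih x).1) h4 x hx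
      · rw [hE x hx, hg0]
    intro l hl
    cases l with
    | nil => simp at hl
    | cons x l => exact (ih x).2 (h5 x) l (by simpa using hl)

theorem eq_of_subset {N : ℕ} {S T : Set (List ℂ)} {p : ℤ[X]} (hS : TameCount N S p)
    (hT : TameCount N T p) (hST : S ⊆ T) {l : List ℂ} (hl : l.length = N) (h : l ∈ T) : l ∈ S := by
  by_contra hlS
  rw [← Set.sdiff_union_of_subset hST] at hT
  have := IteratedCount.diff (fun _ _ _ _ => IsTameIntegral.sub) Set.disjoint_sdiff_left hT hS
  rw [sub_self] at this
  exact (nonneg_and_eq_empty this).2 rfl l hl ⟨h, hlS⟩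

theorem singleton : ∀ {N : ℕ} {l : List ℂ}, l.length = N → TameCount N {l} 1
  | 0, l, h => by simp [TameCount, IteratedCount, List.length_eq_zero_iff.1 h]
  | N + 1, [], h => by simp at h
  | N + 1, a :: l, h => by
    classical
    refine ⟨Pi.single a 1, .single a 1, fun x => ?_⟩
    by_cases hx : x = a
    · subst hx
      simpa using singleton (l := l) (by simpa using h)
    · rw [Pi.single_eq_of_ne hx]
      exact IteratedCount.empty .zero fun l' _ => by simp [hx]

theorem line : ∀ {N : ℕ} (a d : Fin N → ℂ), d ≠ 0 →
    TameCount N {l | ∃ t : ℂ, List.ofFn (a + t • d) = l} X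
  | 0, a, d, hd => absurd (Subsingleton.elim _ _) hd
  | N + 1, a, d, hd => by
    classical
    -- If the line is constant in the first coordinate, its only non-empty fibre is again a line;
    -- otherwise every fibre is a point and the constant `1` integrates to `X`.
    by_cases h0 : d 0 = 0
    · have hd' : (fun i => d (Fin.succ i)) ≠ 0 := fun h => hd (by
        funext i
        exact Fin.cases h0 (fun i => congrFun h i) i)
      refine ⟨Pi.single (a 0) X, .single _ _, fun x => ?_⟩
      by_cases hx : x = a 0
      · subst hx
        rw [Pi.single_eq_same]
        convert line (fun i => a (Fin.succ i)) _ hd' using 1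
        ext l
        simp [List.ofFn_succ, h0]
        rfl
      · rw [Pi.single_eq_of_ne hx]
        refine IteratedCount.empty .zero fun l _ => ?_
        rintro ⟨t, ht⟩
        simp only [List.ofFn_succ, List.cons.injEq] at ht
        exact hx (by simpa [h0] using ht.1.symm)
    · refine ⟨fun _ => 1, by simpa using IsTameIntegral.const (t := (X : ℤ[X])) (1 : ℤ[X]),
        fun x => ?_⟩
      convert singleton (l := List.ofFn fun i => a (Fin.succ i) + (x - a 0) / d 0 * d (Fin.succ i))
        List.length_ofFn using 1
      ext l
      simp only [List.ofFn_succ, Set.mem_ofPred_eq, List.cons.injEq, Pi.add_apply, Pi.smul_apply,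
        smul_eq_mul, Set.mem_singleton_iff]
      constructor
      · rintro ⟨t, rfl, rfl⟩
        simp [h0]
      · rintro rfl
        exact ⟨(x - a 0) / d 0, by field_simp; ring, rfl⟩

end TameCount

/-- A subset of `ℂ^N` as a set of lists. -/
def toLists {N : ℕ} (V : Set (Fin N → ℂ)) : Set (List ℂ) := List.ofFn '' V

/-! ### Passage between subsets of `ℂ^N` and sets of lists -/

theorem ofFn_mem_toLists {N : ℕ} {V : Set (Fin N → ℂ)} {v : Fin N → ℂ} :
    List.ofFn v ∈ toLists V ↔ v ∈ V :=
  List.ofFn_injective.mem_set_image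

theorem length_eq_iff_exists_ofFn {N : ℕ} {l : List ℂ} :
    l.length = N ↔ ∃ v : Fin N → ℂ, List.ofFn v = l := by
  constructor
  · rintro rfl
    exact ⟨l.get, List.ofFn_get l⟩
  · rintro ⟨v, rfl⟩
    exact List.length_ofFn

theorem disjoint_toLists {N : ℕ} {V W : Set (Fin N → ℂ)} (h : Disjoint V W) :
    Disjoint (toLists V) (toLists W) :=
  (Set.disjoint_image_iff List.ofFn_injective).2 h

theorem toLists_union {N : ℕ} (V W : Set (Fin N → ℂ)) :
    toLists (V ∪ W) = toLists V ∪ toLists W := Set.image_union _ _ _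

theorem toLists_fiber {i j : ℕ} (V : Set (Fin (i + j) → ℂ)) (w : Fin i → ℂ) :
    toLists (fiber V w) = {l | List.ofFn w ++ l ∈ toLists V} := by
  ext l
  constructor
  · rintro ⟨v, hv, rfl⟩
    exact ⟨_, hv, List.ofFn_fin_append w v⟩
  · rintro ⟨u, hu, h⟩
    have hl : l.length = j := by
      have := congrArg List.length h
      simp at this
      omega
    obtain ⟨v, rfl⟩ := length_eq_iff_exists_ofFn.1 hl
    rw [← List.ofFn_fin_append] at h
    obtain rfl := List.ofFn_injective h
    exact ⟨v, hu, rfl⟩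

theorem mem_proj_iff {i j : ℕ} (V : Set (Fin (i + j) → ℂ)) (w : Fin i → ℂ) :
    w ∈ proj V ↔ ∃ v, Fin.append w v ∈ V := by
  constructor
  · rintro ⟨u, hu, rfl⟩
    exact ⟨fun k => u (Fin.natAdd i k), by rwa [Fin.append_castAdd_natAdd]⟩
  · rintro ⟨v, hv⟩
    exact ⟨_, hv, by funext k; simp⟩

theorem mem_toLists_proj_iff {i j : ℕ} (V : Set (Fin (i + j) → ℂ)) (w : List ℂ)
    (hw : w.length = i) : w ∈ toLists (proj V) ↔ ∃ v, v.length = j ∧ w ++ v ∈ toLists V := by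
  obtain ⟨w, rfl⟩ := length_eq_iff_exists_ofFn.1 hw
  rw [ofFn_mem_toLists, mem_proj_iff]
  constructor
  · rintro ⟨v, hv⟩
    exact ⟨List.ofFn v, List.length_ofFn, by rwa [← List.ofFn_fin_append, ofFn_mem_toLists]⟩
  · rintro ⟨v, hv, h⟩
    obtain ⟨v, rfl⟩ := length_eq_iff_exists_ofFn.1 hv
    exact ⟨v, by rwa [← List.ofFn_fin_append, ofFn_mem_toLists] at h⟩

/-- The fibration rule, for any way of counting that satisfies it on sets of lists. -/
theorem IteratedCount.toLists_fibration {R : Type*} [CommRing R] {I : (ℂ → R) → R → Prop} {q : R}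
    (hI0 : I 0 0) (hI : ∀ h p, I h p → I (fun x => q * h x) (q * p)) {i j : ℕ}
    {V : Set (Fin (i + j) → ℂ)} {p : R}
    (hV : ∀ w ∈ proj V, IteratedCount I j (toLists (fiber V w)) q)
    (hp : IteratedCount I i (toLists (proj V)) p) :
    IteratedCount I (i + j) (toLists V) (q * p) := by
  refine IteratedCount.fibration hI0 hI (mem_toLists_proj_iff V) (fun w hw hwP => ?_) hp
  obtain ⟨w, rfl⟩ := length_eq_iff_exists_ofFn.1 hw
  rw [← toLists_fiber]
  exact hV w (ofFn_mem_toLists.1 hwP)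

theorem TameCount.finite {N : ℕ} {V : Set (Fin N → ℂ)} (hV : V.Finite) :
    TameCount N (toLists V) ((V.ncard : ℕ) : ℤ[X]) := by
  induction V, hV using Set.Finite.induction_on with
  | empty => simpa using IteratedCount.empty .zero fun l _ => by simp [toLists]
  | @insert a s ha hs ih =>
    rw [Set.ncard_insert_of_notMem ha hs, Set.insert_eq, Set.union_comm, toLists_union]
    push_cast
    refine IteratedCount.union (fun _ _ _ _ => IsTameIntegral.add)
      (disjoint_toLists (Set.disjoint_singleton_right.2 ha)) ih ?_
    simpa [toLists] using singleton (l := List.ofFn a) List.length_ofFn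

/-- Each counting rule is a property of the tame integral: normalization on points and lines,
linearity, and homogeneity for fibrations. -/
theorem IsConstructibleCount.tameCount {N : ℕ} {V : Set (Fin N → ℂ)} {p : ℤ[X]}
    (h : IsConstructibleCount V p) : TameCount N (toLists V) p := by
  induction h with
  | finite V hV => exact .finite hV
  | @line N L hL =>
    obtain ⟨d, hd, hs⟩ := finrank_eq_one_iff'.1 hL
    have hne : (L : Set (Fin N → ℂ)).Nonempty := by
      rw [Set.nonempty_iff_ne_empty]
      intro h
      rw [AffineSubspace.coe_eq_bot_iff] at h
      rw [h, AffineSubspace.direction_bot, finrank_bot] at hL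
      exact zero_ne_one hL
    obtain ⟨a, ha⟩ := hne
    convert TameCount.line a (d : Fin N → ℂ) (by simpa using hd) using 1
    ext l
    constructor
    · rintro ⟨v, hv, rfl⟩
      obtain ⟨t, ht⟩ := hs ⟨v -ᵥ a, AffineSubspace.vsub_mem_direction hv ha⟩
      refine ⟨t, ?_⟩
      have h : t • (d : Fin N → ℂ) = v - a := congrArg Subtype.val ht
      rw [h, add_sub_cancel]
    · rintro ⟨t, rfl⟩
      refine ⟨_, ?_, rfl⟩
      have := AffineSubspace.vadd_mem_of_mem_direction (L.direction.smul_mem t d.2) ha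
      rwa [vadd_eq_add, add_comm] at this
  | add V W p q _ _ hd _ _ ihp ihq =>
    rw [toLists_union]
    exact IteratedCount.union (fun _ _ _ _ => IsTameIntegral.add) (disjoint_toLists hd) ihp ihq
  | sub V W p q _ _ hd _ _ ihp ihq =>
    rw [toLists_union] at ihp
    exact IteratedCount.diff (fun _ _ _ _ => IsTameIntegral.sub) (disjoint_toLists hd) ihp ihq
  | fibration _ V p q _ _ _ ihq ihp =>
    exact IteratedCount.toLists_fibration .zero (fun _ _ => IsTameIntegral.mul_left _) ihq ihp

/-! ### A cone in `ℤ[∞, ℵ₀]` that contains all counting polynomials -/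

/-- The elements of `ℤ[∞, ℵ₀]` that either lie in `ℤ[∞]` and are nonnegative, or have a positive
constant term and a negative linear term with respect to `ℵ₀`. -/
def InCone (q : CountRing) : Prop :=
  (∃ a, EventuallyNonneg a ∧ q = C a) ∨ EventuallyPos (q.coeff 0) ∧ EventuallyPos (-q.coeff 1)

namespace InCone

theorem C {a : ℤ[X]} (ha : EventuallyNonneg a) : InCone (C a) := .inl ⟨a, ha, rfl⟩

theorem zero : InCone 0 := by simpa using C .zero

theorem one : InCone 1 := by simpa using C .one

theorem coeff_zero_nonneg {q : CountRing} (h : InCone q) : EventuallyNonneg (q.coeff 0) := by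
  rcases h with ⟨a, ha, rfl⟩ | h
  · simpa using ha
  · exact h.1.nonneg

theorem coeff_one_nonpos {q : CountRing} (h : InCone q) : EventuallyNonneg (-q.coeff 1) := by
  rcases h with ⟨a, ha, rfl⟩ | h
  · simpa [coeff_C] using EventuallyNonneg.zero
  · exact h.2.nonneg

theorem eq_C {q : CountRing} (h : InCone q) (h1 : q.coeff 1 = 0) :
    EventuallyNonneg (q.coeff 0) ∧ q = Polynomial.C (q.coeff 0) := by
  rcases h with ⟨a, ha, rfl⟩ | h
  · simpa using ha
  · exact absurd (by rw [h1, neg_zero]) h.2.ne_zero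

theorem add {p q : CountRing} (hp : InCone p) (hq : InCone q) : InCone (p + q) := by
  have h0 := hp.coeff_zero_nonneg
  have h1 := hp.coeff_one_nonpos
  have h2 := hq.coeff_zero_nonneg
  have h3 := hq.coeff_one_nonpos
  rcases hp with ⟨a, ha, rfl⟩ | hp
  · rcases hq with ⟨b, hb, rfl⟩ | hq
    · exact .inl ⟨a + b, ha.add hb, by simp⟩
    · refine .inr ⟨?_, ?_⟩ <;> rw [add_comm, coeff_add]
      · exact hq.1.add_nonneg h0
      · rw [neg_add]
        exact hq.2.add_nonneg h1
  · refine .inr ⟨?_, ?_⟩ <;> rw [coeff_add]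
    · exact hp.1.add_nonneg h2
    · rw [neg_add]
      exact hp.2.add_nonneg h3

theorem mul_C {p : CountRing} {b : ℤ[X]} (hp : InCone p) (hb : EventuallyNonneg b) :
    InCone (p * Polynomial.C b) := by
  by_cases h0 : b = 0
  · subst h0
    simpa using zero
  rcases hp with ⟨a, ha, rfl⟩ | hp
  · exact .inl ⟨a * b, ha.mul hb, by simp⟩
  · refine .inr ⟨?_, ?_⟩ <;> rw [coeff_mul_C]
    · exact hp.1.mul (hb.pos h0)
    · rw [← neg_mul]
      exact hp.2.mul (hb.pos h0)

/-- Membership involves only the terms modulo `ℵ₀²` when the linear term is nonzero, and `(a -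
bℵ₀)(c - dℵ₀)` has constant term `ac` and linear term `-(ad + bc)`. -/
theorem mul {p q : CountRing} (hp : InCone p) (hq : InCone q) : InCone (p * q) := by
  rcases hq with ⟨b, hb, rfl⟩ | hq
  · exact hp.mul_C hb
  rcases hp with ⟨a, ha, rfl⟩ | hp
  · rw [mul_comm]
    exact mul_C (.inr hq) ha
  · refine .inr ⟨?_, ?_⟩
    · rw [mul_coeff_zero]
      exact hp.1.mul hq.1
    · rw [mul_coeff_one]
      have := (hp.1.mul hq.2).add_nonneg (hp.2.mul hq.1).nonneg
      convert this using 1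
      ring

theorem eq_zero_of_add {p q : CountRing} (hp : InCone p) (hq : InCone q) (h : p + q = 0) :
    p = 0 ∧ q = 0 := by
  have h1 : p.coeff 1 = 0 ∧ q.coeff 1 = 0 := by
    have := hp.coeff_one_nonpos.eq_zero_of_add hq.coeff_one_nonpos
      (by rw [← neg_add, ← coeff_add, h, coeff_zero, neg_zero])
    simpa using this
  have h0 := hp.coeff_zero_nonneg.eq_zero_of_add hq.coeff_zero_nonneg
    (by rw [← coeff_add, h, coeff_zero])
  rw [(hp.eq_C h1.1).2, (hq.eq_C h1.2).2, h0.1, h0.2]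
  simp

/-- Negative linear terms cannot cancel each other, so `ℵ₀` cannot disappear from a sum in the cone.
-/
theorem of_add_eq_C {p q : CountRing} (hp : InCone p) (hq : InCone q) {a : ℤ[X]}
    (h : p + q = Polynomial.C a) :
    p = Polynomial.C (p.coeff 0) ∧ q = Polynomial.C (q.coeff 0) := by
  have := hp.coeff_one_nonpos.eq_zero_of_add hq.coeff_one_nonpos
    (by rw [← neg_add, ← coeff_add, h, coeff_C_succ, neg_zero])
  simp only [neg_eq_zero] at this
  exact ⟨(hp.eq_C this.1).2, (hq.eq_C this.2).2⟩

theorem infty_sub_natCast (n : ℕ) : InCone (infty - n) := by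
  have := C (EventuallyNonneg.X_sub_natCast n)
  rwa [C_sub, map_natCast] at this

theorem infty_sub_alephZero : InCone (infty - alephZero) := by
  refine .inr ⟨?_, ?_⟩
  · filter_upwards [eventually_gt_atTop (0 : ℤ)] with x hx
    simpa [infty, alephZero] using hx
  · exact .of_forall fun x => by simp [infty, alephZero]

end InCone

/-! ### Integration of step functions on the line -/

/-- The counts of points, of cofinite subsets and of complements of countably infinite subsets of
the affine line. -/
inductive StepCount : Set ℂ → CountRing → Prop
  | point (a : ℂ) : StepCount {a} 1
  | cofinite (E : Finset ℂ) : StepCount (↑E)ᶜ (infty - E.card)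
  | cocountable (M : Set ℂ) (hc : M.Countable) (hi : M.Infinite) :
      StepCount Mᶜ (infty - alephZero)

/-- `h` is a sum of step functions with values in the cone, and `p` is the corresponding sum of
counts. The integral `p` is not determined by `h`. -/
inductive StepIntegral : (ℂ → CountRing) → CountRing → Prop
  | zero : StepIntegral 0 0
  | add_step {h : ℂ → CountRing} {p : CountRing} {B : Set ℂ} {c q : CountRing}
      (hh : StepIntegral h p) (hB : StepCount B c) (hq : InCone q) :
      StepIntegral (h + B.indicator fun _ => q) (p + q * c)

theorem StepCount.inCone {B : Set ℂ} {c : CountRing} (h : StepCount B c) : InCone c := by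
  cases h with
  | point a => exact .one
  | cofinite E => exact .infty_sub_natCast _
  | cocountable M hc hi => exact .infty_sub_alephZero

/-- The generic value is the one taken off a countable set. A step on the complement of a countably
infinite set only drops from `q` to `0`, so the generic value is exceeded, in the order given by the
cone, at finitely many points at most. -/
theorem StepCount.exists_generic {B : Set ℂ} {c q : CountRing} (h : StepCount B c)
    (hq : InCone q) : ∃ g, {x | B.indicator (fun _ => q) x ≠ g}.Countable ∧
      {x | ¬ InCone (g - B.indicator (fun _ => q) x)}.Finite := by
  classical
  cases h with
  | point a =>
    refine ⟨0, (Set.countable_singleton a).mono fun x hx => ?_,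
      (Set.finite_singleton a).subset fun x hx => ?_⟩ <;> by_contra hne <;> apply hx <;>
      rw [Set.indicator_of_notMem hne]
    simpa using InCone.zero
  | cofinite E =>
    refine ⟨q, E.countable_toSet.mono fun x hx => ?_,
      E.finite_toSet.subset fun x hx => ?_⟩ <;> by_contra hne <;> apply hx <;>
      rw [Set.indicator_of_mem hne]
    simpa using InCone.zero
  | cocountable M hc hi =>
    refine ⟨q, hc.mono fun x hx => ?_, ?_⟩
    · by_contra hne
      exact hx (Set.indicator_of_mem (s := Mᶜ) hne _)
    · convert Set.finite_empty
      refine Set.eq_empty_of_forall_notMem fun x hx => hx ?_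
      by_cases hM : x ∈ Mᶜ
      · simpa [Set.indicator_of_mem hM] using InCone.zero
      · simpa [Set.indicator_of_notMem hM] using hq

theorem exists_notMem_of_countable {s : Set ℂ} (h : s.Countable) : ∃ x, x ∉ s := by
  by_contra! hs
  exact not_countable_complex (by rwa [← Set.eq_univ_of_forall hs])

/-- A nonzero step on `Mᶜ` with `M` countably infinite takes two values infinitely often, so it is
not constant off a finite set. The other steps are tame. -/
theorem StepCount.isTameIntegral {B : Set ℂ} {c q g : CountRing} (h : StepCount B c)
    (hg : {x | B.indicator (fun _ => q) x ≠ g}.Finite) :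
    IsTameIntegral infty (B.indicator fun _ => q) (q * c) := by
  classical
  cases h with
  | point a =>
    rw [mul_one, Set.indicator_singleton]
    exact .single a q
  | cofinite E =>
    have := IsTameIntegral.of_finset (t := infty) (h := Set.indicator (↑E)ᶜ fun _ => q) (g := q) E
      fun x hx => Set.indicator_of_mem (by simpa using hx) _
    rw [Finset.sum_eq_zero, add_zero, mul_comm] at this
    · exact this
    · intro x hx
      exact Set.indicator_of_notMem (by simpa using hx) _
  | cocountable M hc hi =>
    have : q = 0 := by
      by_contra hq
      obtain ⟨x, hx⟩ := exists_notMem_of_countable (hc.union hg.countable)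
      simp only [Set.mem_union, not_or, Set.mem_ofPred_eq, not_not] at hx
      rw [Set.indicator_of_mem (by simpa using hx.1)] at hx
      refine hi (hg.subset fun y hy => ?_)
      rw [Set.mem_ofPred_eq, Set.indicator_of_notMem (by simpa using hy), ← hx.2]
      exact Ne.symm hq
    subst this
    rw [Set.indicator_zero, zero_mul]
    exact .zero

theorem StepCount.of_mul_eq_C {B : Set ℂ} {c q : CountRing} (h : StepCount B c) (hq : InCone q)
    {a : ℤ[X]} (ha : q * c = C a) :
    q = C (q.coeff 0) ∧ ∃ g, {x | B.indicator (fun _ => q) x ≠ g}.Finite := by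
  have h1 : (q * c).coeff 1 = 0 := by rw [ha, coeff_C_succ]
  cases h with
  | point b =>
    rw [mul_one] at h1
    refine ⟨(hq.eq_C h1).2, 0, (Set.finite_singleton b).subset fun x hx => ?_⟩
    by_contra hne
    exact hx (Set.indicator_of_notMem hne _)
  | cofinite E =>
    have e : infty - (E.card : CountRing) = C (X - (E.card : ℤ[X])) := by simp [infty]
    rw [e, coeff_mul_C] at h1
    have hX : X - (E.card : ℤ[X]) ≠ 0 := by simpa using X_sub_C_ne_zero (E.card : ℤ)
    refine ⟨(hq.eq_C ((mul_eq_zero.1 h1).resolve_right hX)).2, q,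
      E.finite_toSet.subset fun x hx => ?_⟩
    by_contra hne
    exact hx (Set.indicator_of_mem (s := (↑E : Set ℂ)ᶜ) hne _)
  | cocountable M hc hi =>
    -- The linear term of `q (∞ - ℵ₀)` is `q₁ ∞ - q₀`, where `q₀` and `-q₁` are eventually
    -- nonnegative; its vanishing forces `q = 0`.
    have e : q.coeff 0 + -q.coeff 1 * X = 0 := by
      rw [mul_coeff_one] at h1
      simp only [infty, alephZero, coeff_sub, coeff_C_succ, coeff_X_one, coeff_C_zero,
        coeff_X_zero] at h1
      linear_combination -h1
    have hX : EventuallyNonneg X := by simpa using EventuallyNonneg.X_sub_natCast 0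
    obtain ⟨h2, h3⟩ := hq.coeff_zero_nonneg.eq_zero_of_add (hq.coeff_one_nonpos.mul hX) e
    have h4 := (hq.eq_C (by simpa using h3)).2
    refine ⟨h4, 0, ?_⟩
    rw [h4, h2]
    simp

namespace StepIntegral

theorem step {B : Set ℂ} {c q : CountRing} (hB : StepCount B c) (hq : InCone q) :
    StepIntegral (B.indicator fun _ => q) (q * c) := by
  simpa using add_step .zero hB hq

theorem add {h h' : ℂ → CountRing} {p p' : CountRing} (H : StepIntegral h p)
    (H' : StepIntegral h' p') : StepIntegral (h + h') (p + p') := by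
  induction H' with
  | zero => simpa using H
  | add_step _ hB hq ih =>
    rw [← add_assoc, ← add_assoc]
    exact add_step ih hB hq

theorem sum {ι : Type*} (s : Finset ι) {h : ι → ℂ → CountRing} {p : ι → CountRing}
    (H : ∀ i ∈ s, StepIntegral (h i) (p i)) : StepIntegral (∑ i ∈ s, h i) (∑ i ∈ s, p i) := by
  classical
  induction s using Finset.induction_on with
  | empty => exact .zero
  | insert a s ha ih =>
    rw [Finset.sum_insert ha, Finset.sum_insert ha]
    exact (H a (Finset.mem_insert_self _ _)).add
      (ih fun i hi => H i (Finset.mem_insert_of_mem hi))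

theorem mul_left {q : CountRing} (hq : InCone q) {h : ℂ → CountRing} {p : CountRing}
    (H : StepIntegral h p) : StepIntegral (fun x => q * h x) (q * p) := by
  induction H with
  | zero => simpa using! zero
  | add_step _ hB hq' ih =>
    convert add_step ih hB (hq.mul hq') using 1
    · funext x
      simp only [Pi.add_apply, mul_add, Set.indicator_mul_right]
    · ring

theorem inCone {h : ℂ → CountRing} {p : CountRing} (H : StepIntegral h p) : InCone p := by
  induction H with
  | zero => exact .zero
  | add_step _ hB hq ih => exact ih.add (hq.mul hB.inCone)

theorem exists_generic {h : ℂ → CountRing} {p : CountRing} (H : StepIntegral h p) :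
    ∃ g, {x | h x ≠ g}.Countable ∧ {x | ¬ InCone (g - h x)}.Finite := by
  induction H with
  | zero => exact ⟨0, by simp, by simp [InCone.zero]⟩
  | add_step _ hB hq ih =>
    obtain ⟨g, h1, h2⟩ := ih
    obtain ⟨g', h1', h2'⟩ := hB.exists_generic hq
    refine ⟨g + g', (h1.union h1').mono fun x hx => ?_, (h2.union h2').subset fun x hx => ?_⟩ <;>
      by_contra hne <;>
      simp only [Set.mem_union, not_or, Set.mem_ofPred_eq, not_not] at hne <;> apply hx
    · rw [Pi.add_apply, hne.1, hne.2]
    · rw [Pi.add_apply, add_sub_add_comm]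
      exact hne.1.add hne.2

/-- Although `StepIntegral` is not single-valued, it has only one value on functions constant off a
finite set: the summands inherit this property, so cocountable steps contribute nothing. -/
theorem isTameIntegral {h : ℂ → CountRing} {p : CountRing} (H : StepIntegral h p) :
    ∀ {r : CountRing}, {x | h x ≠ r}.Finite → IsTameIntegral infty h p := by
  induction H with
  | zero => exact fun _ => .zero
  | @add_step h p B c q hh hB hq ih =>
    intro r hr
    obtain ⟨g, h1, h2⟩ := hh.exists_generic
    obtain ⟨g', h1', h2'⟩ := hB.exists_generic hq
    -- The generic values are compared at a point outside a countable set.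
    have hgr : g + g' = r := by
      obtain ⟨x, hx⟩ := exists_notMem_of_countable ((h1.union h1').union hr.countable)
      simp only [Set.mem_union, not_or, Set.mem_ofPred_eq, not_not, Pi.add_apply] at hx
      rw [← hx.2, hx.1.1, hx.1.2]
    -- Off a finite set both defects `g - h x` and `g' - step x` lie in the cone and add up to `0`,
    -- so both vanish.
    have key : ∀ x ∉ ({x | (h + B.indicator fun _ => q) x ≠ r} ∪
        ({x | ¬ InCone (g - h x)} ∪ {x | ¬ InCone (g' - B.indicator (fun _ => q) x)})),
        h x = g ∧ B.indicator (fun _ => q) x = g' := by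
      intro x hx
      simp only [Set.mem_union, not_or, Set.mem_ofPred_eq, not_not, Pi.add_apply] at hx
      obtain ⟨h3, h4⟩ := hx.2.1.eq_zero_of_add hx.2.2
        (by rw [← add_sub_add_comm, hx.1, hgr, sub_self])
      exact ⟨(sub_eq_zero.1 h3).symm, (sub_eq_zero.1 h4).symm⟩
    have hfin := hr.union (h2.union h2')
    refine (ih (r := g) (hfin.subset fun x hx => ?_)).add
      (hB.isTameIntegral (g := g') (hfin.subset fun x hx => ?_))
    · by_contra hne
      exact hx (key x hne).1
    · by_contra hne
      exact hx (key x hne).2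

/-- Without cancellation, every summand of an integral in `ℤ[∞]` lies in `ℤ[∞]`, and
`StepCount.of_mul_eq_C` treats a single step. -/
theorem of_eq_C {h : ℂ → CountRing} {P : CountRing} (H : StepIntegral h P) :
    ∀ {p : ℤ[X]}, P = C p →
      (∀ x, h x = C ((h x).coeff 0)) ∧ ∃ r, {x | h x ≠ r}.Finite := by
  induction H with
  | zero => exact fun _ => ⟨fun x => by simp, 0, by simp⟩
  | @add_step _ _ B _ _ hh hB hq ih =>
    intro p hp
    obtain ⟨h1, h2⟩ := hh.inCone.of_add_eq_C (hq.mul hB.inCone) hp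
    obtain ⟨h3, r, h4⟩ := ih h1
    obtain ⟨h5, r', h6⟩ := hB.of_mul_eq_C hq h2
    refine ⟨fun x => ?_, r + r', (h4.union h6).subset fun x hx => ?_⟩
    · rw [Pi.add_apply, coeff_add, C_add, ← h3 x]
      congr 1
      by_cases hx : x ∈ B
      · rw [Set.indicator_of_mem hx, ← h5]
      · rw [Set.indicator_of_notMem hx]
        simp
    · by_contra hne
      simp only [Set.mem_union, not_or, Set.mem_ofPred_eq, not_not] at hne
      exact hx (by rw [Pi.add_apply, hne.1, hne.2])

end StepIntegral

theorem IsTameIntegral.stepIntegral {h : ℂ → ℤ[X]} {p : ℤ[X]} (H : IsTameIntegral X h p)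
    (h0 : ∀ x, EventuallyNonneg (h x)) : StepIntegral (fun x => C (h x)) (C p) := by
  classical
  obtain ⟨g, E, hE, rfl⟩ := H.exists_finset
  obtain ⟨y, hy⟩ := E.finite_toSet.exists_notMem
  have hg : EventuallyNonneg g := hE y hy ▸ h0 y
  -- The function splits into its generic value on the complement of `E` and its values at the
  -- points of `E`. All of them are nonnegative, as the cone requires.
  convert (StepIntegral.step (.cofinite E) (.C hg)).add
    (StepIntegral.sum E fun a _ => StepIntegral.step (.point a) (.C (h0 a))) using 1
  · funext x
    simp only [Pi.add_apply, Finset.sum_apply]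
    by_cases hx : x ∈ E
    · rw [Set.indicator_of_notMem (by simpa using hx), zero_add, Finset.sum_eq_single x]
      · simp
      · intro b _ hb
        exact Set.indicator_of_notMem (by simpa using hb.symm) _
      · exact fun h => absurd hx h
    · rw [Set.indicator_of_mem (by simpa using hx), hE x hx, Finset.sum_eq_zero, add_zero]
      intro b hb
      exact Set.indicator_of_notMem (by rintro rfl; exact hx hb) _
  · simp [infty, mul_comm]

/-! ### Counting in `ℤ[∞, ℵ₀]` -/

/-- Iterated counting in `ℤ[∞, ℵ₀]` of sets of lists. -/
abbrev WildCount : ℕ → Set (List ℂ) → CountRing → Prop := IteratedCount StepIntegral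

namespace WildCount

theorem inCone {N : ℕ} {S : Set (List ℂ)} {p : CountRing} (h : WildCount N S p) : InCone p := by
  cases N with
  | zero =>
    simp only [WildCount, IteratedCount] at h
    subst h
    split_ifs
    exacts [.one, .zero]
  | succ N => exact h.choose_spec.1.inCone

theorem of_tameCount : ∀ {N : ℕ} {S : Set (List ℂ)} {p : ℤ[X]}, TameCount N S p →
    WildCount N S (C p)
  | 0, S, p, hp => by
    simp only [TameCount, WildCount, IteratedCount] at *
    rw [hp]
    split_ifs <;> simp
  | N + 1, S, p, ⟨h, hp, hS⟩ =>
    ⟨_, hp.stepIntegral fun x => (TameCount.nonneg_and_eq_empty (hS x)).1,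
      fun x => of_tameCount (hS x)⟩

theorem eq_C_of_tameCount : ∀ {N : ℕ} {S : Set (List ℂ)} {q : CountRing} {p : ℤ[X]},
    WildCount N S q → TameCount N S p → q = C p
  | 0, S, q, p, hq, hp => by
    simp only [TameCount, WildCount, IteratedCount] at *
    rw [hp, hq]
    split_ifs <;> simp
  | N + 1, S, q, p, ⟨H, hq, hH⟩, ⟨h, hp, hh⟩ => by
    -- The fibre counts agree by induction, so only the two integrals of one function, constant off
    -- a finite set, remain to be compared.
    obtain rfl : H = fun x => C (h x) := funext fun x => eq_C_of_tameCount (hH x) (hh x)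
    have hp' : IsTameIntegral infty (fun x => C (h x)) (C p) := hp.map C
    obtain ⟨g, hg, -⟩ := id hp'
    refine (hq.isTameIntegral (r := g) (hg.subset fun x hx => ?_)).unique hp'
    exact sub_ne_zero.2 hx

theorem tameCount_of_C : ∀ {N : ℕ} {S : Set (List ℂ)} {p : ℤ[X]}, WildCount N S (C p) →
    TameCount N S p
  | 0, S, p, hp => by
    simp only [TameCount, WildCount, IteratedCount] at *
    apply C_injective
    rw [hp]
    split_ifs <;> simp
  | N + 1, S, p, ⟨H, hp, hH⟩ => by
    obtain ⟨h1, r, hr⟩ := hp.of_eq_C rfl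
    refine ⟨fun x => (H x).coeff 0, ?_, fun x => tameCount_of_C (h1 x ▸ hH x)⟩
    -- Taking the constant term with respect to `ℵ₀` turns the integral over `ℤ[∞, ℵ₀]` into one
    -- over `ℤ[∞]`.
    have := (hp.isTameIntegral hr).map (constantCoeff (R := ℤ[X]))
    simpa [infty, constantCoeff_apply] using this

end WildCount

theorem IsCount.wildCount {N : ℕ} {V : Set (Fin N → ℂ)} {p : CountRing} (h : IsCount V p) :
    WildCount N (toLists V) p := by
  induction h with
  | constructible V p _ hp => exact .of_tameCount hp.tameCount
  | add V W p q hd _ _ ihp ihq =>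
    rw [toLists_union]
    exact IteratedCount.union (fun _ _ _ _ => StepIntegral.add) (disjoint_toLists hd) ihp ihq
  | @fibration i j _ V p q _ _ ihq ihp =>
    -- Multiplication by `q` preserves step integrals only if `q` lies in the cone, which is known
    -- when some fibre has count `q`. Over an empty base `q` is arbitrary, but then `p = 0`.
    by_cases hV : (proj V).Nonempty
    · obtain ⟨w, hw⟩ := hV
      exact IteratedCount.toLists_fibration .zero
        (fun _ _ => StepIntegral.mul_left (ihq w hw).inCone) ihq ihp
    · have hP := Set.not_nonempty_iff_eq_empty.1 hV
      have hp : p = C 0 := ihp.eq_C_of_tameCount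
        (IteratedCount.empty .zero fun l _ => by simp [hP, toLists])
      rw [hp, C_0, mul_zero]
      have hV' : V = ∅ := Set.image_eq_empty.1 hP
      exact IteratedCount.empty .zero fun l _ => by simp [hV', toLists]
  | cocountable M hc hi =>
    refine ⟨Mᶜ.indicator fun _ => 1, by simpa using StepIntegral.step (.cocountable M hc hi) .one,
      fun x => ?_⟩
    by_cases hx : x ∈ M
    · rw [Set.indicator_of_notMem (by simpa using hx)]
      refine IteratedCount.empty .zero fun l _ => ?_
      rintro ⟨v, hv, h⟩
      simp only [List.ofFn_succ, List.cons.injEq] at h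
      exact hv (by rwa [h.1])
    · rw [Set.indicator_of_mem (by simpa using hx)]
      have : [] ∈ {l | x :: l ∈ toLists {v : Fin 1 → ℂ | v 0 ∉ M}} :=
        ⟨fun _ => x, hx, by simp⟩
      simp [IteratedCount, this]

/-- A set with an algebraic counting polynomial in `ℤ[∞]` has no other one. -/
theorem IsCount.unique {N : ℕ} {V : Set (Fin N → ℂ)} {p q : CountRing} (hp : IsCount V p)
    (h : InZInfty p) (hq : IsCount V q) : q = p := by
  obtain ⟨p, rfl⟩ := h
  exact hq.wildCount.eq_C_of_tameCount hp.wildCount.tameCount_of_C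

/-- Nested sets with the same algebraic counting polynomial in `ℤ[∞]` are equal. -/
theorem IsCount.eq_of_subset {N : ℕ} {V W : Set (Fin N → ℂ)} {p : CountRing} (hV : IsCount V p)
    (hW : IsCount W p) (h : InZInfty p) (hVW : V ⊆ W) : V = W := by
  obtain ⟨p, rfl⟩ := h
  refine hVW.antisymm fun v hv => ofFn_mem_toLists.1 ?_
  exact TameCount.eq_of_subset hV.wildCount.tameCount_of_C hW.wildCount.tameCount_of_C
    (Set.image_mono hVW) List.length_ofFn (ofFn_mem_toLists.2 hv)

/-! ### Solution sets are determined by their truncations -/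

section Truncation

variable {n m : ℕ}

/-- The tuples `f` and `g` have the same coefficients of order at most `ℓ`. -/
def AgreeUpTo {ι : Type*} (ℓ : ℕ) (f g : ι → MvPowerSeries (Fin n) ℂ) : Prop :=
  ∀ (j : ι) (μ : Fin n →₀ ℕ), μ.degree ≤ ℓ →
    MvPowerSeries.coeff μ (f j) = MvPowerSeries.coeff μ (g j)

theorem AgreeUpTo.mono {ι : Type*} {ℓ ℓ' : ℕ} (h : ℓ ≤ ℓ') {f g : ι → MvPowerSeries (Fin n) ℂ}
    (H : AgreeUpTo ℓ' f g) : AgreeUpTo ℓ f g :=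
  fun j μ hμ => H j μ (hμ.trans h)

theorem truncate_eq_iff (r : LinearOrder (DVar n m)) (ℓ : ℕ)
    (f g : Fin m → MvPowerSeries (Fin n) ℂ) :
    truncate r ℓ f = truncate r ℓ g ↔ AgreeUpTo ℓ f g := by
  have hr := @Finset.range_orderEmbOfFin _ r (truncIndex n m ℓ) _ rfl
  constructor
  · intro h j μ hμ
    have : (j, μ) ∈ (truncIndex n m ℓ : Set (DVar n m)) := by simpa [truncIndex] using hμ
    rw [← hr] at this
    obtain ⟨k, hk⟩ := this
    have := congrFun h k
    simpa only [truncate, hk] using this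
  · intro h
    funext k
    have := hr ▸ Set.mem_range_self (f := @Finset.orderEmbOfFin _ r (truncIndex n m ℓ) _ rfl) k
    exact h _ _ (by simpa [truncIndex] using this)

/-- Every coefficient of the value of `Ψ` depends on finitely many coefficients only. -/
def DeterminedByTruncation (Ψ : (Fin m → MvPowerSeries (Fin n) ℂ) → MvPowerSeries (Fin n) ℂ) :
    Prop :=
  ∀ d, ∃ ℓ, ∀ f g, AgreeUpTo ℓ f g → ∀ μ : Fin n →₀ ℕ, μ.degree ≤ d →
    MvPowerSeries.coeff μ (Ψ f) = MvPowerSeries.coeff μ (Ψ g)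

namespace DeterminedByTruncation

variable {Ψ Φ : (Fin m → MvPowerSeries (Fin n) ℂ) → MvPowerSeries (Fin n) ℂ}

theorem const (a : MvPowerSeries (Fin n) ℂ) :
    DeterminedByTruncation fun _ : Fin m → MvPowerSeries (Fin n) ℂ => a :=
  fun _ => ⟨0, fun _ _ _ _ _ => rfl⟩

theorem component (j : Fin m) :
    DeterminedByTruncation fun f : Fin m → MvPowerSeries (Fin n) ℂ => f j :=
  fun d => ⟨d, fun _ _ h μ hμ => h j μ hμ⟩

theorem add (hΨ : DeterminedByTruncation Ψ) (hΦ : DeterminedByTruncation Φ) :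
    DeterminedByTruncation fun f => Ψ f + Φ f := fun d => by
  obtain ⟨ℓ, h⟩ := hΨ d
  obtain ⟨ℓ', h'⟩ := hΦ d
  refine ⟨max ℓ ℓ', fun f g hfg μ hμ => ?_⟩
  rw [map_add, map_add, h f g (hfg.mono (le_max_left _ _)) μ hμ,
    h' f g (hfg.mono (le_max_right _ _)) μ hμ]

theorem mul (hΨ : DeterminedByTruncation Ψ) (hΦ : DeterminedByTruncation Φ) :
    DeterminedByTruncation fun f => Ψ f * Φ f := fun d => by
  classical
  obtain ⟨ℓ, h⟩ := hΨ d
  obtain ⟨ℓ', h'⟩ := hΦ d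
  refine ⟨max ℓ ℓ', fun f g hfg μ hμ => ?_⟩
  rw [MvPowerSeries.coeff_mul, MvPowerSeries.coeff_mul]
  refine Finset.sum_congr rfl fun p hp => ?_
  have hdeg : p.1.degree + p.2.degree = μ.degree := by
    rw [← Finset.HasAntidiagonal.mem_antidiagonal.1 hp, map_add]
  rw [h f g (hfg.mono (le_max_left _ _)) p.1 (by omega),
    h' f g (hfg.mono (le_max_right _ _)) p.2 (by omega)]

theorem sum {ι : Type*} (s : Finset ι)
    {Ψ : ι → (Fin m → MvPowerSeries (Fin n) ℂ) → MvPowerSeries (Fin n) ℂ}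
    (h : ∀ i ∈ s, DeterminedByTruncation (Ψ i)) :
    DeterminedByTruncation fun f => ∑ i ∈ s, Ψ i f := by
  classical
  induction s using Finset.induction_on with
  | empty => simpa using const 0
  | insert a s ha ih =>
    simp only [Finset.sum_insert ha]
    exact (h a (Finset.mem_insert_self _ _)).add
      (ih fun i hi => h i (Finset.mem_insert_of_mem hi))

theorem prod {ι : Type*} (s : Finset ι)
    {Ψ : ι → (Fin m → MvPowerSeries (Fin n) ℂ) → MvPowerSeries (Fin n) ℂ}
    (h : ∀ i ∈ s, DeterminedByTruncation (Ψ i)) :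
    DeterminedByTruncation fun f => ∏ i ∈ s, Ψ i f := by
  classical
  induction s using Finset.induction_on with
  | empty => simpa using const 1
  | insert a s ha ih =>
    simp only [Finset.prod_insert ha]
    exact (h a (Finset.mem_insert_self _ _)).mul
      (ih fun i hi => h i (Finset.mem_insert_of_mem hi))

theorem pow (hΨ : DeterminedByTruncation Ψ) (k : ℕ) :
    DeterminedByTruncation fun f => Ψ f ^ k := by
  simpa using prod (Finset.range k) fun _ _ => hΨ

theorem pderiv (hΨ : DeterminedByTruncation Ψ) (i : Fin n) :
    DeterminedByTruncation fun f => MvPowerSeries.pderiv ℂ i (Ψ f) := fun d => by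
  -- A coefficient of the derivative comes from one of order one higher.
  obtain ⟨ℓ, h⟩ := hΨ (d + 1)
  refine ⟨ℓ, fun f g hfg μ hμ => ?_⟩
  rw [MvPowerSeries.coeff_pderiv, MvPowerSeries.coeff_pderiv, h f g hfg]
  rw [map_add, Finsupp.degree_single]
  omega

theorem iterDeriv (hΨ : DeterminedByTruncation Ψ) (μ : Fin n →₀ ℕ) :
    DeterminedByTruncation fun f => iterDeriv μ (Ψ f) := by
  unfold DiffCount.iterDeriv
  induction List.finRange n with
  | nil => exact hΨ
  | cons i L ih =>
    simp only [List.foldr_cons]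
    induction μ i with
    | zero => exact ih
    | succ k ihk =>
      simp only [Function.iterate_succ_apply']
      exact ihk.pderiv i

end DeterminedByTruncation

theorem determinedByTruncation_evalDiff {Ω : Set (Fin n → ℂ)} {F : Subring (GenericFunction Ω)}
    (ζ : Fin n → ℂ) (p : MvPolynomial (DVar n m) F) :
    DeterminedByTruncation fun f => evalDiff ζ p f :=
  .sum _ fun _ _ => (DeterminedByTruncation.const _).mul <| .prod _ fun v _ =>
    ((DeterminedByTruncation.component v.1).iterDeriv v.2).pow _

theorem exists_evalCoeff_eq (p : MvPolynomial (DVar n m) ℂ) :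
    ∃ ℓ, ∀ f g : Fin m → MvPowerSeries (Fin n) ℂ, AgreeUpTo ℓ f g →
      evalCoeff p f = evalCoeff p g := by
  classical
  refine ⟨p.support.sup fun α => α.support.sup fun v => v.2.degree, fun f g h => ?_⟩
  rw [evalCoeff, evalCoeff, MvPolynomial.eval_eq, MvPolynomial.eval_eq]
  refine Finset.sum_congr rfl fun α hα => ?_
  congr 1
  refine Finset.prod_congr rfl fun v hv => ?_
  rw [h v.1 v.2]
  exact (Finset.le_sup (f := fun v : DVar n m => v.2.degree) hv).trans
    (Finset.le_sup (f := fun α : DVar n m →₀ ℕ => α.support.sup fun v => v.2.degree) hα)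

variable {Ω : Set (Fin n → ℂ)} {F : Subring (GenericFunction Ω)}

/-- Each coefficient of a differential equation's value, and each value of a polynomial in `ℂ[G]`,
depends on a finite truncation. It can be tested on a solution agreeing with `f` that far; this
solution may vary with the condition, so inequations cause no trouble. -/
theorem SigmaSystem.mem_Sol_of_truncate_mem (r : LinearOrder (DVar n m)) (S : SigmaSystem n m F)
    (ζ : Fin n → ℂ) (f : Fin m → MvPowerSeries (Fin n) ℂ)
    (h : ∀ᶠ ℓ in atTop, truncate r ℓ f ∈ S.SolTrunc r ζ ℓ) : f ∈ S.Sol ζ := by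
  have key : ∀ ℓ, ∃ g ∈ S.Sol ζ, AgreeUpTo ℓ f g := fun ℓ => by
    obtain ⟨k, hk, g, hg, hgf⟩ := ((eventually_ge_atTop ℓ).and h).exists
    exact ⟨g, hg, ((truncate_eq_iff r k f g).1 hgf.symm).mono hk⟩
  refine ⟨fun p hp => ?_, fun p hp => ?_, fun p hp => ?_⟩
  · ext μ
    obtain ⟨ℓ, hℓ⟩ := determinedByTruncation_evalDiff ζ p μ.degree
    obtain ⟨g, hg, hfg⟩ := key ℓ
    exact (hℓ f g hfg μ le_rfl).trans (congrArg _ (hg.1 p hp))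
  · obtain ⟨ℓ, hℓ⟩ := exists_evalCoeff_eq p
    obtain ⟨g, hg, hfg⟩ := key ℓ
    rw [hℓ f g hfg, hg.2.1 p hp]
  · obtain ⟨ℓ, hℓ⟩ := exists_evalCoeff_eq p
    obtain ⟨g, hg, hfg⟩ := key ℓ
    rw [hℓ f g hfg]
    exact hg.2.2 p hp

theorem SigmaSystem.Sol_eq_of_SolTrunc_eq (r : LinearOrder (DVar n m)) (S₁ S₂ : SigmaSystem n m F)
    (ζ : Fin n → ℂ) (hsub : S₁.Sol ζ ⊆ S₂.Sol ζ)
    (h : ∀ᶠ ℓ in atTop, S₁.SolTrunc r ζ ℓ = S₂.SolTrunc r ζ ℓ) : S₁.Sol ζ = S₂.Sol ζ :=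
  hsub.antisymm fun f hf => S₁.mem_Sol_of_truncate_mem r ζ f <| h.mono fun ℓ hℓ => by
    rw [hℓ]
    exact ⟨f, hf, rfl⟩

theorem IsDiffCount.isCount {r : LinearOrder (DVar n m)} {S : SigmaSystem n m F} {ζ : Fin n → ℂ}
    {ℓ : ℕ} {p : CountRing} (h : IsDiffCount r S ζ ℓ p) : IsCount (S.SolTrunc r ζ ℓ) p := by
  obtain ⟨T, -, -, -, hT, hp⟩ := h
  rwa [hT]

end Truncation

/-! ### Values of differential counting polynomials -/

theorem coeff_coeff_toValueRing (p : CountRing) (k j : ℕ) :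
    ((toValueRing p).coeff (k : ℚ)).coeff j = ((p.coeff j).coeff k : ℚ) := by
  induction p using Polynomial.induction_on' with
  | add p q hp hq => simp [hp, hq]
  | monomial i p =>
    induction p using Polynomial.induction_on' with
    | add p q hp hq =>
      rw [map_add, map_add, AddMonoidAlgebra.coeff_add, Finsupp.add_apply, coeff_add, hp, hq]
      simp
    | monomial l a =>
      have : toValueRing (monomial i (monomial l a)) =
          AddMonoidAlgebra.single (l : ℚ) (C (a : ℚ) * X ^ i) := by
        have ha : (a : ValueRing) = AddMonoidAlgebra.single 0 (C (a : ℚ)) := by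
          ext
          simp [AddMonoidAlgebra.intCast_def]
        simp [toValueRing, eval₂_monomial, AddMonoidAlgebra.single_pow, ha,
          AddMonoidAlgebra.single_mul_single]
      rw [this, AddMonoidAlgebra.coeff_single, Finsupp.single_apply, coeff_monomial]
      by_cases h1 : l = k <;> by_cases h2 : i = j <;>
        simp [h1, h2, coeff_X_pow, coeff_monomial, eq_comm (a := j)]

theorem toValueRing_injective : Function.Injective toValueRing := fun p q h => by
  ext j k
  have := coeff_coeff_toValueRing p k j
  rw [h, coeff_coeff_toValueRing] at this
  exact_mod_cast this.symm

/-- The exponent `e_0 + e_1 ℓ + … + e_n ℓ^n / n!` as a polynomial in `ℓ`. -/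
def exponentPoly {n : ℕ} (e : Fin (n + 1) → ℚ) : ℚ[X] :=
  ∑ i : Fin (n + 1), C (e i / (Nat.factorial i : ℚ)) * X ^ (i : ℕ)

theorem eval_exponentPoly {n : ℕ} (e : Fin (n + 1) → ℚ) (x : ℚ) :
    (exponentPoly e).eval x =
      ∑ i : Fin (n + 1), e i * (x ^ (i : ℕ) / (Nat.factorial i : ℚ)) := by
  simp only [exponentPoly, eval_finsetSum, eval_mul, eval_C, eval_pow, eval_X]
  exact Finset.sum_congr rfl fun i _ => by ring

theorem exponentPoly_injective {n : ℕ} :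
    Function.Injective (exponentPoly : (Fin (n + 1) → ℚ) → ℚ[X]) := fun e e' h => by
  have key : ∀ (e : Fin (n + 1) → ℚ) (i : Fin (n + 1)),
      (exponentPoly e).coeff i = e i / (Nat.factorial i : ℚ) := fun e i => by
    simp [exponentPoly, finsetSum_coeff, coeff_X_pow, Fin.val_inj]
  funext i
  have := key e i
  rw [h, key] at this
  have hi : (Nat.factorial i : ℚ) ≠ 0 := by exact_mod_cast Nat.factorial_ne_zero _
  field_simp at this
  exact this.symm

theorem eventually_eval_natCast_ne_zero {p : ℚ[X]} (hp : p ≠ 0) :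
    ∀ᶠ ℓ : ℕ in atTop, p.eval (ℓ : ℚ) ≠ 0 := by
  rw [← Nat.cofinite_eq_atTop]
  exact (Nat.cast_injective (R := ℚ)).tendsto_cofinite.eventually
    (p := fun x => p.eval x ≠ 0)
    ((finite_setOfPred_isRoot hp).subset fun x hx => not_not.1 hx)

/-- Distinct exponent polynomials agree at finitely many `ℓ` only, so for large `ℓ` no two terms
with exponents in `E` merge. -/
theorem eventually_injOn_exponent {n : ℕ} (E : Finset (Fin (n + 1) → ℚ)) :
    ∀ᶠ ℓ : ℕ in atTop, ∀ e ∈ E, ∀ e' ∈ E,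
      (exponentPoly e).eval (ℓ : ℚ) = (exponentPoly e').eval (ℓ : ℚ) → e = e' := by
  rw [Filter.eventually_all_finset]
  intro e _
  rw [Filter.eventually_all_finset]
  intro e' _
  by_cases h : e = e'
  · exact .of_forall fun _ _ => h
  · filter_upwards [eventually_eval_natCast_ne_zero
      (sub_ne_zero.2 (exponentPoly_injective.ne h))] with ℓ hℓ h'
    exact absurd (by rw [eval_sub, h', sub_self]) hℓ

theorem coeff_valueAt {n : ℕ} (ℓ : ℕ) (p : DiffCountRing n) (x : ℚ) :
    (valueAt ℓ p).coeff x = ∑ e ∈ p.coeff.support,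
      if (exponentPoly e).eval (ℓ : ℚ) = x then (p.coeff e).map (evalRingHom (ℓ : ℚ)) else 0 := by
  classical
  simp only [valueAt, Finsupp.sum, AddMonoidAlgebra.coeff_sum, Finsupp.finsetSum_apply,
    AddMonoidAlgebra.coeff_single, Finsupp.single_apply, eval_exponentPoly]

theorem coeff_valueAt_exponent {n : ℕ} {ℓ : ℕ} {E : Finset (Fin (n + 1) → ℚ)}
    (hE : ∀ e ∈ E, ∀ e' ∈ E,
      (exponentPoly e).eval (ℓ : ℚ) = (exponentPoly e').eval (ℓ : ℚ) → e = e')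
    {p : DiffCountRing n} (hp : p.coeff.support ⊆ E) {e : Fin (n + 1) → ℚ} (he : e ∈ E) :
    (valueAt ℓ p).coeff ((exponentPoly e).eval (ℓ : ℚ)) =
      (p.coeff e).map (evalRingHom (ℓ : ℚ)) := by
  rw [coeff_valueAt, Finset.sum_eq_single e]
  · rw [if_pos rfl]
  · exact fun e' he' hne => if_neg fun h => hne (hE _ (hp he') _ he h)
  · intro h
    rw [if_pos rfl, Finsupp.notMem_support_iff.1 h, Polynomial.map_zero]

theorem eq_of_eventually_valueAt_eq {n : ℕ} {p q : DiffCountRing n}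
    (h : ∀ᶠ ℓ in atTop, valueAt ℓ p = valueAt ℓ q) : p = q := by
  classical
  rw [← AddMonoidAlgebra.coeff_inj]
  ext1 e
  by_cases he : e ∈ p.coeff.support ∪ q.coeff.support
  · rw [← sub_eq_zero]
    ext1 j
    by_contra hne
    -- At one sufficiently large `ℓ` the values agree, the exponents are separated, and the
    -- differing coefficient polynomials in `ℓ` still differ.
    obtain ⟨ℓ, ⟨h1, h2⟩, h3⟩ := ((h.and (eventually_injOn_exponent
      (p.coeff.support ∪ q.coeff.support))).and (eventually_eval_natCast_ne_zero hne)).exists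
    have := coeff_valueAt_exponent h2 (p := p) Finset.subset_union_left he
    rw [h1, coeff_valueAt_exponent h2 (p := q) Finset.subset_union_right he] at this
    have := congrArg (fun a => a.coeff j) this
    simp only [coeff_map, coe_evalRingHom] at this
    exact h3 (by rw [coeff_sub, eval_sub, this, sub_self])
  · simp only [Finset.mem_union, not_or, Finsupp.notMem_support_iff] at he
    rw [he.1, he.2]

theorem inZInfty_of_toValueRing_eq_valueAt {n : ℕ} {p : DiffCountRing n} (hp : NoAleph p)
    {ℓ : ℕ} {c : CountRing} (h : toValueRing c = valueAt ℓ p) : InZInfty c := by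
  refine ⟨c.coeff 0, ?_⟩
  ext j k
  cases j with
  | zero => simp
  | succ j =>
    have := coeff_coeff_toValueRing c k (j + 1)
    rw [h, coeff_valueAt, finsetSum_coeff, Finset.sum_eq_zero] at this
    · rw [coeff_C_succ, Polynomial.coeff_zero]
      exact_mod_cast this.symm
    · intro e _
      obtain ⟨a, ha⟩ := hp e
      rw [ha]
      split_ifs <;> simp

end DiffCount

end

/-! ### The main theorem -/

open DiffCount
theorem mainTheorem1 {n m : ℕ} (r : LinearOrder (DVar n m)) (hr : IsOrderlyRanking r)
    (Ω : Set (Fin n → ℂ)) (F : Subring (GenericFunction Ω)) (hF : IsMeromorphicField Ω F)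
    (ζ : Fin n → ℂ) (hζ : ζ ∈ Ω) (S₁ S₂ : SigmaSystem n m F)
    (hS₁ : S₁.IsSystem) (hS₂ : S₂.IsSystem)
    (hpole₁ : S₁.HolomorphicAt ζ) (hpole₂ : S₂.HolomorphicAt ζ)
    (hsub : S₁.Sol ζ ⊆ S₂.Sol ζ) :
    (∀ c₁ c₂ : ℕ → CountRing, IsCountingSeq r S₁ ζ c₁ → IsCountingSeq r S₂ ζ c₂ →
      (∀ ℓ, InZInfty (c₁ ℓ)) → (∀ ℓ, InZInfty (c₂ ℓ)) →
      (S₁.Sol ζ = S₂.Sol ζ ↔ ∀ ℓ, c₁ ℓ = c₂ ℓ) ∧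
      ∀ c : ℕ → CountRing, IsCountingSeq r S₁ ζ c → c = c₁) ∧
    (∀ p₁ p₂ : DiffCountRing n, IsDiffCountPoly r S₁ ζ p₁ → IsDiffCountPoly r S₂ ζ p₂ →
      NoAleph p₁ → NoAleph p₂ →
      (S₁.Sol ζ = S₂.Sol ζ ↔ p₁ = p₂) ∧
      ∀ p : DiffCountRing n, IsDiffCountPoly r S₁ ζ p → p = p₁) := by
  have trunc_eq : S₁.Sol ζ = S₂.Sol ζ → ∀ ℓ, S₁.SolTrunc r ζ ℓ = S₂.SolTrunc r ζ ℓ :=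
    fun h ℓ => by rw [SigmaSystem.SolTrunc, h, SigmaSystem.SolTrunc]
  have trunc_sub : ∀ ℓ, S₁.SolTrunc r ζ ℓ ⊆ S₂.SolTrunc r ζ ℓ := fun ℓ => Set.image_mono hsub
  constructor
  · intro c₁ c₂ h₁ h₂ hc₁ _
    refine ⟨⟨fun h ℓ => ?_, fun h => ?_⟩, fun c hc => funext fun ℓ => ?_⟩
    · have := (h₂ ℓ).isCount
      rw [← trunc_eq h ℓ] at this
      exact ((h₁ ℓ).isCount.unique (hc₁ ℓ) this).symm
    · refine SigmaSystem.Sol_eq_of_SolTrunc_eq r S₁ S₂ ζ hsub (.of_forall fun ℓ => ?_)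
      exact (h₁ ℓ).isCount.eq_of_subset (h ℓ ▸ (h₂ ℓ).isCount) (hc₁ ℓ) (trunc_sub ℓ)
    · exact (h₁ ℓ).isCount.unique (hc₁ ℓ) (hc ℓ).isCount
  · rintro p₁ p₂ ⟨c₁, h₁, hp₁⟩ ⟨c₂, h₂, hp₂⟩ hn₁ _
    -- The absence of `ℵ₀` from `p₁` controls the counting sequence for large `ℓ` only, which
    -- suffices for both evaluation in `R` and recovery of solution sets from truncations.
    have hc₁ : ∀ᶠ ℓ in atTop, InZInfty (c₁ ℓ) :=
      hp₁.mono fun ℓ hℓ => inZInfty_of_toValueRing_eq_valueAt hn₁ hℓ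
    refine ⟨⟨fun h => eq_of_eventually_valueAt_eq ?_, ?_⟩,
      fun p ⟨c, hc, hp⟩ => eq_of_eventually_valueAt_eq ?_⟩
    · filter_upwards [hp₁, hp₂, hc₁] with ℓ e₁ e₂ hℓ
      have := (h₂ ℓ).isCount
      rw [← trunc_eq h ℓ] at this
      rw [← e₁, ← e₂, (h₁ ℓ).isCount.unique hℓ this]
    · rintro rfl
      refine SigmaSystem.Sol_eq_of_SolTrunc_eq r S₁ S₂ ζ hsub ?_
      filter_upwards [hp₁, hp₂, hc₁] with ℓ e₁ e₂ hℓ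
      have e : c₁ ℓ = c₂ ℓ := toValueRing_injective (e₁.trans e₂.symm)
      exact (h₁ ℓ).isCount.eq_of_subset (e ▸ (h₂ ℓ).isCount) hℓ (trunc_sub ℓ)
    · filter_upwards [hp₁, hp, hc₁] with ℓ e₁ e hℓ
      rw [← e₁, ← e, (h₁ ℓ).isCount.unique hℓ (hc ℓ).isCount]
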